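/- **Setting.** Fix $T>0$. Let $D$ be a compact metric space with a Borel probability measure $\mu_D$, and let $\Omega(D)=C([0,T];D)$ with the uniform topology. The action of a path $\omega\in\Omega(D)$ is $\mathcal A_T(\omega)=T\int_0^T\frac12|\dot\omega(t)|^2\,dt$ if $\omega$ is absolutely continuous and $+\infty$ otherwise, where $|\dot\omega(t)|=\limsup_{s\to t}\frac{d(\omega(s),\omega(t))}{|s-t|}$ (the norm of the velocity when $D\subset\mathbb R^d$ with the Euclidean distance, or when $D$ is a Riemannian manifold with its geodesic distance). Let $\Gamma(D)$ be the set of probability measures on $D\times D$ with both marginals equal to $\mu_D$, with the narrow topology; for a measure-preserving $g:D\to D$ put $\gamma_g=(\boldsymbol i\times g)_\#\mu_D\in\Gamma(D)$, where $\boldsymbol i$ is the identity. For $\eta,\gamma\in\Gamma(D)$, a *generalized incompressible flow from $\eta$ to $\gamma$* is a probability measure $\boldsymbol\nu$ on $\Omega(D)\times D$ (pairs $(\omega,a)$) such that the law of $a$ is $\mu_D$, the law of $\omega(t)$ is $\mu_D$ for every $t\in[0,T]$, the law of $(a,\omega(0))$ is $\eta$, and the law of $(a,\omega(T))$ is $\gamma$.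 Define $\overline\delta(\eta,\gamma)\in[0,+\infty]$ by $$\overline\delta^{\,2}(\eta,\gamma)=\inf_{\boldsymbol\nu}\int_{\Omega(D)\times D}\mathcal A_T(\omega)\,d\boldsymbol\nu(\omega,a),$$ the infimum being over all such flows ($\inf\emptyset=+\infty$). For $D\subset\mathbb R^d$ compact, call a map on $D$ (resp. on $[0,T]\times D$) smooth if it is the restriction of a $C^\infty$ map on $\mathbb R^d$ (resp. $\mathbb R\times\mathbb R^d$). Let $\mathrm{SDiff}(D)$ be the set of homeomorphisms $h$ of $D$ with $h,h^{-1}$ smooth and $h_\#\mu_D=\mu_D$. The Arnold distance $\delta(f,h)\in[0,+\infty]$ is defined by $$\delta^2(f,h)=\inf_g\ T\int_0^T\int_D\tfrac12|\dot g(t,x)|^2\,d\mu_D(x)\,dt,$$ the infimum being over all smooth $g:[0,T]\times D\to D$ with $g(t,\cdot)\in\mathrm{SDiff}(D)$ for all $t$, $g(0,\cdot)=f$ and $g(T,\cdot)=h$. **Theorem.** 1. Let $D\subset\mathbb R^d$ be compact, with any Borel probability measure $\mu_D$ on $D$ (for example normalized Lebesgue measure if $|D|>0$). Then: - for all $\eta,\gamma\in\Gamma(D)$,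 if at least one generalized incompressible flow from $\eta$ to $\gamma$ exists, the infimum defining $\overline\delta^{\,2}(\eta,\gamma)$ is attained; - $(\eta,\gamma)\mapsto\overline\delta(\eta,\gamma)$ is narrowly lower semicontinuous on $\Gamma(D)\times\Gamma(D)$; - $\overline\delta(\gamma_{\boldsymbol i},\gamma_h)\le\delta(\boldsymbol i,h)$ for every $h\in\mathrm{SDiff}(D)$. 2. $\sup_{\eta,\gamma\in\Gamma(D)}\overline\delta(\eta,\gamma)\le\sqrt d$ when $D=[0,1]^d$ with Lebesgue measure, and when $D=\mathbb T^d=\mathbb R^d/\mathbb Z^d$ is the flat torus with its geodesic distance and its canonical probability measure. 3. Let $D,D'$ be compact metric spaces with Borel probability measures $\mu_D,\mu_{D'}$, and let $f:D'\to D$ be $K$-Lipschitz (for example with $K=\mathrm{Lip}(f)$) with $f_\#\mu_{D'}=\mu_D$. Then $$\sup_{\gamma\in\Gamma(D)}\overline\delta_D(\gamma_{\boldsymbol i},\gamma)\le K\sup_{\gamma'\in\Gamma(D')}\overline\delta_{D'}(\gamma_{\boldsymbol i},\gamma'),$$ with the convention $0\cdot\infty=0$ on the right. -/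

import Mathlib

open Set Filter Topology MeasureTheory
open scoped NNReal ENNReal

noncomputable section

namespace GenFlow

/-! ### Paths and their action -/

/-- The space `Ω(D) = C([0,T]; D)` of continuous paths (with the uniform topology). -/
abbrev PathSpace (T : ℝ) (X : Type*) [TopologicalSpace X] : Type _ := C(Icc (0 : ℝ) T, X)

/-- Paths carry the Borel σ-algebra of the uniform topology. -/
instance instMeasurableSpacePathSpace (T : ℝ) (X : Type*) [TopologicalSpace X] :
    MeasurableSpace (PathSpace T X) := borel _

instance instBorelSpacePathSpace (T : ℝ) (X : Type*) [TopologicalSpace X] :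
    BorelSpace (PathSpace T X) := ⟨rfl⟩

/-- The initial time `0` as a point of `[0,T]`. -/
def startTime (T : ℝ) [hT : Fact (0 < T)] : Icc (0 : ℝ) T := ⟨0, left_mem_Icc.2 hT.out.le⟩

/-- The final time `T` as a point of `[0,T]`. -/
def endTime (T : ℝ) [hT : Fact (0 < T)] : Icc (0 : ℝ) T := ⟨T, right_mem_Icc.2 hT.out.le⟩

/-- A path as a function on `ℝ`, constant before time `0` and after time `T`. -/
def extendPath {T : ℝ} [hT : Fact (0 < T)] {X : Type*} [TopologicalSpace X]
    (ω : PathSpace T X) : ℝ → X :=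
  IccExtend hT.out.le ω

/-- The speed `|u̇(t)| = limsup_{s → t, s ≠ t} d(u(s), u(t)) / |s - t|` of a curve at time `t`.
For a curve in a normed space it is the norm of the derivative wherever the curve is
differentiable (`speed_eq_enorm_deriv` below); in a Riemannian manifold (such as the flat torus)
it is the Riemannian norm of the velocity. -/
def speed {X : Type*} [PseudoMetricSpace X] (u : ℝ → X) (t : ℝ) : ℝ≥0∞ :=
  limsup (fun s => edist (u s) (u t) / edist s t) (𝓝[≠] t)

open Classical in
/-- The action `T ∫₀ᵀ ½ |ω̇(t)|² dt` of an absolutely continuous path; it is `+∞` for every other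
path. For paths in a Euclidean space see `pathAction_eq_lintegral_deriv` below. -/
def pathAction {T : ℝ} [Fact (0 < T)] {X : Type*} [PseudoMetricSpace X] (ω : PathSpace T X) :
    ℝ≥0∞ :=
  if AbsolutelyContinuousOnInterval (extendPath ω) 0 T then
    ENNReal.ofReal T * ∫⁻ t in Icc (0 : ℝ) T, speed (extendPath ω) t ^ 2 / 2
  else ∞

/-! ### Measure-preserving plans and generalized incompressible flows -/

section Plans

variable {X : Type*} [MeasurableSpace X]

/-- The measure-preserving plans `Γ(D)`: probability measures on `D × D` both of whose marginals
are the reference measure `μ`. -/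
def plans (μ : Measure X) : Set (ProbabilityMeasure (X × X)) :=
  {γ | (γ : Measure (X × X)).map Prod.fst = μ ∧ (γ : Measure (X × X)).map Prod.snd = μ}

/-- The plan `γ_g = (i × g)_# μ` induced by a map `g : D → D`. -/
def planOfMap (μ : Measure X) (g : X → X) : Measure (X × X) := μ.map fun x => (x, g x)

end Plans

section Flows

variable {X : Type*} [MetricSpace X] [MeasurableSpace X]

/-- `ν`, a probability measure on `Ω(D) × D` (pairs (path `ω`, label `a`)), is a generalized
incompressible flow connecting the plan `η` to the plan `γ`: the labels are distributed as `μ`, at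
every time the positions are distributed as `μ`, and the joint laws of (label, initial position)
and (label, final position) are `η = η_a ⊗ μ` and `γ = γ_a ⊗ μ`. -/
structure IsGenFlow (T : ℝ) [Fact (0 < T)] (μ : Measure X) (η γ : Measure (X × X))
    (ν : ProbabilityMeasure (PathSpace T X × X)) : Prop where
  label : (ν : Measure (PathSpace T X × X)).map Prod.snd = μ
  incompressible : ∀ t : Icc (0 : ℝ) T,
    (ν : Measure (PathSpace T X × X)).map (fun p => p.1 t) = μ
  initial : (ν : Measure (PathSpace T X × X)).map (fun p => (p.2, p.1 (startTime T))) = η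
  final : (ν : Measure (PathSpace T X × X)).map (fun p => (p.2, p.1 (endTime T))) = γ

/-- The action `∫ A_T(ω) dν(ω, a)` of a flow. -/
def flowAction {T : ℝ} [Fact (0 < T)] (ν : ProbabilityMeasure (PathSpace T X × X)) : ℝ≥0∞ :=
  ∫⁻ p, pathAction p.1 ∂(ν : Measure (PathSpace T X × X))

/-- The square of the relaxed distance: the infimum of the action among the generalized
incompressible flows connecting `η` to `γ` (it is `+∞` when there is none). -/
def relaxedDistSq (T : ℝ) [Fact (0 < T)] (μ : Measure X) (η γ : Measure (X × X)) : ℝ≥0∞ :=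
  ⨅ (ν : ProbabilityMeasure (PathSpace T X × X)) (_ : IsGenFlow T μ η γ ν), flowAction ν

/-- The relaxed distance `δ̄(η, γ) ∈ [0, +∞]`. -/
def relaxedDist (T : ℝ) [Fact (0 < T)] (μ : Measure X) (η γ : Measure (X × X)) : ℝ≥0∞ :=
  relaxedDistSq T μ η γ ^ (1 / 2 : ℝ)

end Flows

/-! ### The Arnold distance on a compact set `D ⊆ ℝᵈ` -/

section Arnold

variable {d : ℕ} {D : Set (EuclideanSpace ℝ (Fin d))}

/-- A map `D → ℝᵈ` is smooth if it is the restriction of a `C^∞` map on `ℝᵈ`. -/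
def IsSmoothMap (f : D → EuclideanSpace ℝ (Fin d)) : Prop :=
  ∃ F : EuclideanSpace ℝ (Fin d) → EuclideanSpace ℝ (Fin d),
    ContDiff ℝ (⊤ : ℕ∞) F ∧ ∀ x : D, F x = f x

/-- `SDiff(D)`: the measure-preserving smooth diffeomorphisms of `D`. -/
def SDiff (μ : Measure D) : Set (D ≃ₜ D) :=
  {h | IsSmoothMap (fun x => (h x : EuclideanSpace ℝ (Fin d))) ∧
    IsSmoothMap (fun x => (h.symm x : EuclideanSpace ℝ (Fin d))) ∧
    μ.map h = μ}

/-- `g` (only its values at times in `[0,T]` matter) is a smooth curve in `SDiff(D)` from `f`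
to `h`; smoothness is joint smoothness in `(t, x)` on `[0,T] × D`. -/
structure IsSmoothCurve (T : ℝ) (μ : Measure D) (f h : D ≃ₜ D) (g : ℝ → (D ≃ₜ D)) : Prop where
  mem_sdiff : ∀ t ∈ Icc (0 : ℝ) T, g t ∈ SDiff μ
  smooth : ∃ G : ℝ × EuclideanSpace ℝ (Fin d) → EuclideanSpace ℝ (Fin d),
    ContDiff ℝ (⊤ : ℕ∞) G ∧ ∀ t ∈ Icc (0 : ℝ) T, ∀ x : D, G (t, x) = g t x
  initial : g 0 = f
  final : g T = h

/-- The action `T ∫₀ᵀ ∫_D ½ |ġ(t,x)|² dμ(x) dt`. -/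
def arnoldAction (T : ℝ) (μ : Measure D) (g : ℝ → (D ≃ₜ D)) : ℝ≥0∞ :=
  ENNReal.ofReal T * ∫⁻ t in Icc (0 : ℝ) T, ∫⁻ x,
    ‖derivWithin (fun s => (g s x : EuclideanSpace ℝ (Fin d))) (Icc (0 : ℝ) T) t‖ₑ ^ 2 / 2 ∂μ

/-- The Arnold distance `δ(f, h) ∈ [0, +∞]`; its square is the infimum of the action. -/
def arnoldDist (T : ℝ) (μ : Measure D) (f h : D ≃ₜ D) : ℝ≥0∞ :=
  (⨅ (g : ℝ → (D ≃ₜ D)) (_ : IsSmoothCurve T μ f h g), arnoldAction T μ g) ^ (1 / 2 : ℝ)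

end Arnold

/-! ### The cube and the flat torus -/

/-- The unit cube `[0,1]ᵈ`. -/
def cube (d : ℕ) : Set (EuclideanSpace ℝ (Fin d)) := {x | ∀ i, x i ∈ Icc (0 : ℝ) 1}

/-- The Lebesgue measure on the unit cube. -/
def cubeMeasure (d : ℕ) : Measure (cube d) := Measure.comap Subtype.val volume

/-- The flat torus `𝕋ᵈ = ℝᵈ / ℤᵈ` with its geodesic distance, the Euclidean (`ℓ²`) combination of
the distances of `ℝ / ℤ` in the coordinates. -/
abbrev Torus (d : ℕ) : Type := PiLp 2 fun _ : Fin d => UnitAddCircle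

/-- The canonical probability measure on the torus (product of the Haar measures of `ℝ / ℤ`). -/
def torusMeasure (d : ℕ) : Measure (Torus d) :=
  (Measure.pi fun _ : Fin d => (volume : Measure UnitAddCircle)).map (WithLp.toLp 2)

/-! ### Consistency of the action with the derivative -/

theorem speed_eq_enorm_deriv {E : Type*} [NormedAddCommGroup E] [NormedSpace ℝ E] {X : Set E}
    {u : ℝ → X} {t : ℝ} (h : DifferentiableAt ℝ (fun s => (u s : E)) t) :
    speed u t = ‖deriv (fun s => (u s : E)) t‖ₑ := by
  have h1 := (hasDerivAt_iff_tendsto_slope.1 h.hasDerivAt).enorm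
  refine Tendsto.limsup_eq (h1.congr' ?_)
  filter_upwards [self_mem_nhdsWithin] with s hs
  have hs' : s - t ≠ 0 := sub_ne_zero.2 hs
  rw [slope_def_module, enorm_smul, enorm_inv hs', Subtype.edist_eq, edist_eq_enorm_sub,
    edist_eq_enorm_sub, mul_comm, ENNReal.div_eq_inv_mul, mul_comm]

theorem pathAction_eq_lintegral_deriv {T : ℝ} [hT : Fact (0 < T)] {d : ℕ}
    {D : Set (EuclideanSpace ℝ (Fin d))} {ω : PathSpace T D}
    (hω : AbsolutelyContinuousOnInterval (extendPath ω) 0 T) :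
    pathAction ω = ENNReal.ofReal T * ∫⁻ t in Icc (0 : ℝ) T,
      ‖deriv (fun s => ((extendPath ω s : D) : EuclideanSpace ℝ (Fin d))) t‖ₑ ^ 2 / 2 := by
  have hω' : AbsolutelyContinuousOnInterval
      (fun s => ((extendPath ω s : D) : EuclideanSpace ℝ (Fin d))) 0 T := hω
  have hd := hω'.boundedVariationOn.locallyBoundedVariationOn.ae_differentiableWithinAt
    measurableSet_uIcc
  rw [pathAction, if_pos hω]
  congr 1
  rw [← restrict_Ioo_eq_restrict_Icc]
  refine lintegral_congr_ae ?_
  rw [uIcc_of_le hT.out.le, ← restrict_Ioo_eq_restrict_Icc] at hd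
  filter_upwards [hd, ae_restrict_mem measurableSet_Ioo] with t ht hmem
  rw [speed_eq_enorm_deriv (ht.differentiableAt (Icc_mem_nhds hmem.1 hmem.2))]

end GenFlow

end

open Set Filter Topology MeasureTheory
open scoped NNReal ENNReal ProbabilityTheory

noncomputable section

namespace GenFlow

open AbsolutelyContinuousOnInterval

/-! ### Energy of a curve as a supremum over disjoint intervals -/

section Energy

variable {X : Type*} [PseudoMetricSpace X]

/-! The Euclidean part is the direct method. For paths in `D ⊆ ℝᵈ` the action equals `T/2` times
`pathEnergy`, a supremum of sums of `d(u(a), u(b))² / |b - a|` (`pathAction_eq_pathEnergy`). Each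
sum is continuous under pointwise convergence, so the action is lower semicontinuous; finite energy
forces a 1/2-Hölder modulus, so its sublevels are compact by Arzelà–Ascoli. These two facts lift to
measures on paths: the total action is narrowly lower semicontinuous, and Markov's inequality with
Prokhorov's theorem makes the incompressible flows of bounded action compact
(`isCompact_boundedFlows`). Minimizers follow, and the sublevels of `relaxedDist` are continuous
images of compact sets. The comparison with `arnoldDist` lets each particle `x` follow `t ↦ g t x`.

On the torus, two plans are glued along the label to give a triple (label `a`, start `x`, end `b`),
and an independent uniform point `z` is added. Each particle travels from `x` to `z` in the first
half of the time and from `z` to `b` in the second. Since `z - x` is independent of `x` and `z - b`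
of `b`, every intermediate position is uniform. Each half costs `d/12`, the second moment of a
uniform displacement in `(-1/2, 1/2]ᵈ`, so the squared distance is at most `d/6`
(`relaxedDistSq_torus_le`).

A Lipschitz measure-preserving map carries flows to flows, acting on paths and labels alike, and
multiplies the action by at most `K²`. Every plan downstairs is the image of a plan upstairs, by
disintegration (`exists_plan_map_eq`). This gives the transfer inequality and also the cube: folding
the torus onto the cube is 2-Lipschitz, and `2 √(d/6) ≤ √d`. -/

/-- The sum of the quantities `d(u(a), u(b))² / |b - a|` over a finite family of intervals. -/
def incrementEnergy (u : ℝ → X) (P : ℕ × (ℕ → ℝ × ℝ)) : ℝ≥0∞ :=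
  ∑ i ∈ Finset.range P.1, edist (u (P.2 i).1) (u (P.2 i).2) ^ 2 / edist (P.2 i).1 (P.2 i).2

/-- The energy of a curve: the supremum of the sums `∑ d(u(aᵢ), u(bᵢ))² / |bᵢ - aᵢ|` over finite
families of disjoint subintervals. -/
def pathEnergy (u : ℝ → X) (a b : ℝ) : ℝ≥0∞ := ⨆ P ∈ disjWithin a b, incrementEnergy u P

theorem edist_sq_div_edist (u : ℝ → X) (a b : ℝ) :
    edist (u a) (u b) ^ 2 / edist a b = ENNReal.ofReal (dist (u a) (u b) ^ 2 / dist a b) := by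
  rcases eq_or_ne a b with rfl | h
  · simp
  · rw [ENNReal.ofReal_div_of_pos (dist_pos.2 h), edist_dist, edist_dist,
      ENNReal.ofReal_pow dist_nonneg]

theorem incrementEnergy_eq_ofReal (u : ℝ → X) (P : ℕ × (ℕ → ℝ × ℝ)) :
    incrementEnergy u P = ENNReal.ofReal (∑ i ∈ Finset.range P.1,
      dist (u (P.2 i).1) (u (P.2 i).2) ^ 2 / dist (P.2 i).1 (P.2 i).2) := by
  rw [ENNReal.ofReal_sum_of_nonneg fun _ _ => by positivity]
  exact Finset.sum_congr rfl fun i _ => edist_sq_div_edist u _ _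

theorem edist_sq_le_pathEnergy_mul (u : ℝ → X) {a b s t : ℝ} (hs : s ∈ uIcc a b)
    (ht : t ∈ uIcc a b) : edist (u s) (u t) ^ 2 ≤ pathEnergy u a b * edist s t := by
  have h : edist (u s) (u t) ^ 2 / edist s t ≤ pathEnergy u a b := by
    -- The family made of the single interval between `s` and `t`.
    refine le_trans (le_of_eq ?_) (le_iSup₂_of_le (f := fun P (_ : P ∈ disjWithin a b) =>
      incrementEnergy u P) (1, fun _ => (s, t)) ?_ le_rfl)
    · simp [incrementEnergy]
    · exact ⟨by simp [hs, ht], by simp⟩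
  rcases eq_or_ne s t with rfl | hst
  · simp
  · exact (ENNReal.div_le_iff (by simpa using hst) (edist_ne_top _ _)).1 h

theorem absolutelyContinuousOnInterval_of_pathEnergy_ne_top {u : ℝ → X} {a b : ℝ}
    (h : pathEnergy u a b ≠ ∞) : AbsolutelyContinuousOnInterval u a b := by
  rw [absolutelyContinuousOnInterval_iff]
  intro ε hε
  set C := (pathEnergy u a b).toReal with hC
  have hC0 : 0 ≤ C := ENNReal.toReal_nonneg
  -- By Cauchy–Schwarz the squared sum of increments is at most `C` times the total length; the `+
  -- 1` covers `C = 0`.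
  refine ⟨ε ^ 2 / (C + 1), by positivity, fun P hP hlen => ?_⟩
  have hle : ∑ i ∈ Finset.range P.1,
      dist (u (P.2 i).1) (u (P.2 i).2) ^ 2 / dist (P.2 i).1 (P.2 i).2 ≤ C := by
    refine (ENNReal.ofReal_le_iff_le_toReal h).1 ?_
    rw [← incrementEnergy_eq_ofReal]
    exact le_iSup₂_of_le (f := fun P (_ : P ∈ disjWithin a b) => incrementEnergy u P) P hP le_rfl
  have hcs := Finset.sum_sq_le_sum_mul_sum_of_sq_le_mul (Finset.range P.1)
    (r := fun i => dist (u (P.2 i).1) (u (P.2 i).2))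
    (f := fun i => dist (P.2 i).1 (P.2 i).2)
    (g := fun i => dist (u (P.2 i).1) (u (P.2 i).2) ^ 2 / dist (P.2 i).1 (P.2 i).2)
    (fun _ _ => by positivity) (fun _ _ => by positivity) (fun i _ => by
      rcases eq_or_ne (P.2 i).1 (P.2 i).2 with hi | hi
      · simp [hi]
      · exact (mul_div_cancel₀ _ (dist_pos.2 hi).ne').ge)
  refine lt_of_pow_lt_pow_left₀ 2 hε.le (hcs.trans_lt ?_)
  have h0 : 0 ≤ ∑ i ∈ Finset.range P.1, dist (P.2 i).1 (P.2 i).2 := by positivity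
  rw [lt_div_iff₀ (by positivity)] at hlen
  nlinarith [mul_le_mul_of_nonneg_left hle h0]

theorem _root_.LipschitzWith.comp_absolutelyContinuousOnInterval {Y : Type*}
    [PseudoMetricSpace Y] {f : X → Y} {K : ℝ≥0} (hf : LipschitzWith K f) {u : ℝ → X} {a b : ℝ}
    (hu : AbsolutelyContinuousOnInterval u a b) :
    AbsolutelyContinuousOnInterval (f ∘ u) a b := by
  refine squeeze_zero (fun P => Finset.sum_nonneg fun _ _ => dist_nonneg) (fun P => ?_)
    (by simpa using Tendsto.const_mul (K : ℝ) hu)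
  rw [Finset.mul_sum]
  exact Finset.sum_le_sum fun i _ => hf.dist_le_mul _ _

end Energy

theorem sq_lintegral_le {α : Type*} [MeasurableSpace α] (μ : Measure α) {g : α → ℝ≥0∞}
    (hg : AEMeasurable g μ) : (∫⁻ x, g x ∂μ) ^ 2 ≤ μ univ * ∫⁻ x, g x ^ 2 ∂μ := by
  have h := ENNReal.lintegral_mul_le_Lp_mul_Lq μ Real.HolderConjugate.two_two
    (f := fun _ => 1) aemeasurable_const hg
  simp only [Pi.mul_apply, one_mul, ENNReal.rpow_two, one_pow, lintegral_one] at h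
  calc (∫⁻ x, g x ∂μ) ^ 2 ≤ (μ univ ^ (1 / 2 : ℝ) * (∫⁻ x, g x ^ 2 ∂μ) ^ (1 / 2 : ℝ)) ^ 2 := by
        gcongr
    _ = _ := by
        rw [mul_pow, ← ENNReal.rpow_natCast, ← ENNReal.rpow_natCast, ← ENNReal.rpow_mul,
          ← ENNReal.rpow_mul]
        norm_num


/-! ### Energy and the integral of the squared derivative -/

section Derivative

variable {E : Type*} [NormedAddCommGroup E] [InnerProductSpace ℝ E] [FiniteDimensional ℝ E]
  {u : ℝ → E} {a b : ℝ}

theorem ae_differentiableAt_of_absolutelyContinuousOnInterval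
    (hu : AbsolutelyContinuousOnInterval u a b) :
    ∀ᵐ t, t ∈ uIoc a b → DifferentiableAt ℝ u t := by
  have hd := hu.boundedVariationOn.locallyBoundedVariationOn.ae_differentiableWithinAt_of_mem
  have h1 : ∀ᵐ t : ℝ, t ≠ max a b := by simp [ae_iff, measure_singleton]
  filter_upwards [hd, h1] with t ht hne hmem
  exact (ht (Ioc_subset_Icc_self hmem)).differentiableAt
    (Icc_mem_nhds hmem.1 (lt_of_le_of_ne hmem.2 hne))

/-- The scalar fundamental theorem of calculus is applied to `⟪v, u⟫` with `v = u b - u a`; its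
increment is `‖v‖²` and its derivative at most `‖v‖ ‖u'‖`, and one factor `‖v‖` cancels. -/
theorem edist_le_lintegral_deriv (hu : AbsolutelyContinuousOnInterval u a b) :
    edist (u a) (u b) ≤ ∫⁻ t in uIoc a b, ‖deriv u t‖ₑ := by
  set v := u b - u a with hv
  rcases eq_or_ne v 0 with h0 | h0
  · rw [edist_comm, edist_eq_enorm_sub, ← hv, h0]; simp
  let L : E →L[ℝ] ℝ := innerSL ℝ v
  have hL : ‖L‖ₑ = ‖v‖ₑ := by
    rw [enorm_eq_iff_norm_eq]; exact innerSL_apply_norm ℝ v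
  have hf : AbsolutelyContinuousOnInterval (L ∘ u) a b :=
    L.lipschitz.comp_absolutelyContinuousOnInterval hu
  have hint := hf.integral_deriv_eq_sub
  have hsub : (L ∘ u) b - (L ∘ u) a = ‖v‖ ^ 2 := by
    rw [Function.comp_apply, Function.comp_apply, ← map_sub, ← hv]
    exact real_inner_self_eq_norm_sq v
  have hle : ‖v‖ₑ ^ 2 ≤ ‖v‖ₑ * ∫⁻ t in uIoc a b, ‖deriv u t‖ₑ := by
    calc ‖v‖ₑ ^ 2 = ‖∫ t in a..b, deriv (L ∘ u) t‖ₑ := by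
          rw [hint, hsub, enorm_pow, enorm_norm]
      _ = ‖∫ t in uIoc a b, deriv (L ∘ u) t‖ₑ := by
          rw [enorm_eq_iff_norm_eq]; exact intervalIntegral.norm_integral_eq_norm_integral_uIoc _
      _ ≤ ∫⁻ t in uIoc a b, ‖deriv (L ∘ u) t‖ₑ := enorm_integral_le_lintegral_enorm _
      _ ≤ ∫⁻ t in uIoc a b, ‖v‖ₑ * ‖deriv u t‖ₑ := by
          refine lintegral_mono_ae ?_
          filter_upwards [(ae_restrict_iff' measurableSet_uIoc).2
            (ae_differentiableAt_of_absolutelyContinuousOnInterval hu)] with t ht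
          rw [(L.hasFDerivAt.comp_hasDerivAt t ht.hasDerivAt).deriv, ← hL]
          exact L.le_opENorm _
      _ = _ := lintegral_const_mul' _ _ enorm_ne_top
  rw [edist_comm, edist_eq_enorm_sub, ← hv]
  rw [sq] at hle
  exact (ENNReal.mul_le_mul_iff_right (by simpa using h0) enorm_ne_top).1 hle

theorem pathEnergy_le_lintegral_deriv (hu : AbsolutelyContinuousOnInterval u a b) :
    pathEnergy u a b ≤ ∫⁻ t in uIoc a b, ‖deriv u t‖ₑ ^ 2 := by
  borelize E
  refine iSup₂_le fun P hP => ?_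
  have hsub : ∀ i ∈ Finset.range P.1, uIoc (P.2 i).1 (P.2 i).2 ⊆ uIoc a b := fun i hi =>
    uIoc_subset_of_mem_disjWithin hP (Finset.mem_range.1 hi)
  calc incrementEnergy u P
      ≤ ∑ i ∈ Finset.range P.1, ∫⁻ t in uIoc (P.2 i).1 (P.2 i).2, ‖deriv u t‖ₑ ^ 2 := by
        refine Finset.sum_le_sum fun i hi => ENNReal.div_le_of_le_mul' ?_
        have hac := hu.mono (c := (P.2 i).1) (d := (P.2 i).2)
          (uIcc_subset_uIcc (hP.1 i hi).1 (hP.1 i hi).2)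
        refine (pow_le_pow_left' (edist_le_lintegral_deriv hac) 2).trans ?_
        refine (sq_lintegral_le _ (measurable_deriv u).enorm.aemeasurable).trans ?_
        gcongr
        rw [Measure.restrict_apply_univ, uIoc, Real.volume_Ioc, max_sub_min_eq_abs', edist_dist,
          Real.dist_eq]
    _ = ∫⁻ t in ⋃ i ∈ Finset.range P.1, uIoc (P.2 i).1 (P.2 i).2, ‖deriv u t‖ₑ ^ 2 :=
        (lintegral_biUnion_finset hP.2 (fun _ _ => measurableSet_uIoc) _).symm
    _ ≤ _ := lintegral_mono_set (iUnion₂_subset hsub)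

theorem lintegral_Ioc_eq_sum (f : ℝ → ℝ≥0∞) {h : ℝ} (hh : 0 ≤ h) (n : ℕ) :
    ∫⁻ t in Ioc 0 (n * h), f t = ∑ i ∈ Finset.range n, ∫⁻ t in Ioc 0 h, f (t + i * h) := by
  induction n with
  | zero => simp
  | succ n ih =>
    have h0 : 0 ≤ (n : ℝ) * h := by positivity
    have h1 : (n : ℝ) * h ≤ (n + 1 : ℕ) * h := by push_cast; nlinarith
    rw [Finset.sum_range_succ, ← ih, ← Ioc_union_Ioc_eq_Ioc h0 h1,
      lintegral_union measurableSet_Ioc (Ioc_disjoint_Ioc_of_le le_rfl)]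
    congr 1
    have hmp := measurePreserving_add_right (volume : Measure ℝ) (n * h)
    have := hmp.setLIntegral_comp_preimage_emb
      (measurableEmbedding_addRight _) f (Ioc (n * h) ((n + 1 : ℕ) * h))
    rw [← this, preimage_add_const_Ioc]
    congr 3 <;> push_cast <;> ring

/-- The difference quotients of a curve, constant after time `T`, are controlled by its energy. -/
theorem lintegral_quotient_le_pathEnergy {X : Type*} [PseudoMetricSpace X] {u : ℝ → X}
    (hc : Continuous u) {T : ℝ} (hu : ∀ t, T ≤ t → u t = u T) {n : ℕ}
    {h : ℝ} (hh : 0 < h) (hn : n * h = T) :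
    ∫⁻ t in Ioc 0 T, edist (u (t + h)) (u t) ^ 2 / ENNReal.ofReal h ^ 2 ≤ pathEnergy u 0 T := by
  have hmin : ∀ t, u (min t T) = u t := fun t => by
    rcases le_total t T with ht | ht
    · rw [min_eq_left ht]
    · rw [min_eq_right ht, hu t ht]
  have hT : 0 ≤ T := hn ▸ by positivity
  have hh0 : ENNReal.ofReal h ≠ 0 := by simpa using hh
  rw [← hn, lintegral_Ioc_eq_sum _ hh.le, hn, ← lintegral_finsetSum]
  swap
  · intro i _
    have : Measurable fun t : ℝ => edist (u (t + i * h + h)) (u (t + i * h)) :=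
      Continuous.measurable (by fun_prop)
    exact (this.pow_const 2).div_const _
  have key : ∀ t ∈ Ioc 0 h, ∑ i ∈ Finset.range n,
      edist (u (t + i * h + h)) (u (t + i * h)) ^ 2 / ENNReal.ofReal h ^ 2 ≤
        pathEnergy u 0 T / ENNReal.ofReal h := by
    intro t ht
    -- Clipping the grid at `T` keeps it inside the interval without changing the values of `u`; it
    -- can only shorten the intervals, hence increase the quotients.
    let P : ℕ × (ℕ → ℝ × ℝ) := (n, fun i => (min (t + i * h) T, min (t + (i + 1 : ℕ) * h) T))
    have hmono : Monotone fun i : ℕ => min (t + i * h) T := fun i j hij => by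
      dsimp only; gcongr
    have hP : P ∈ disjWithin 0 T := by
      refine ⟨fun i _ => ?_, ?_⟩
      · rw [uIcc_of_le hT]
        refine ⟨⟨le_min ?_ hT, min_le_right _ _⟩, ⟨le_min ?_ hT, min_le_right _ _⟩⟩ <;>
        · have := ht.1.le
          positivity
      · have : ∀ i, uIoc (P.2 i).1 (P.2 i).2 = Ioc (min (t + i * h) T)
            (min (t + (Order.succ i : ℕ) * h) T) := fun i => uIoc_of_le (hmono i.le_succ)
        simp only [this]
        exact (hmono.pairwise_disjoint_on_Ioc_succ).set_pairwise _
    rw [ENNReal.le_div_iff_mul_le (Or.inl hh0) (Or.inl ENNReal.ofReal_ne_top), Finset.sum_mul]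
    refine le_trans (Finset.sum_le_sum fun i _ => ?_)
      (le_iSup₂_of_le (f := fun P (_ : P ∈ disjWithin 0 T) => incrementEnergy u P) P hP le_rfl)
    have e1 : edist (u (t + i * h + h)) (u (t + i * h)) = edist (u (P.2 i).1) (u (P.2 i).2) := by
      simp only [P, hmin]
      rw [edist_comm]
      congr 2
      push_cast; ring
    have e2 : edist (P.2 i).1 (P.2 i).2 ≤ ENNReal.ofReal h := by
      rw [edist_dist]
      refine ENNReal.ofReal_le_ofReal ?_
      rw [Real.dist_eq, abs_sub_comm]
      refine (abs_min_sub_min_le_max _ _ _ _).trans ?_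
      rw [sub_self, abs_zero, max_eq_left (abs_nonneg _)]
      push_cast
      rw [show t + (i + 1) * h - (t + i * h) = h by ring, abs_of_pos hh]
    rw [e1, ENNReal.div_eq_inv_mul, mul_right_comm, sq (ENNReal.ofReal h),
      ENNReal.mul_inv (Or.inl hh0) (Or.inl ENNReal.ofReal_ne_top), mul_assoc (_⁻¹),
      ENNReal.inv_mul_cancel hh0 ENNReal.ofReal_ne_top, mul_one, ← ENNReal.div_eq_inv_mul]
    gcongr
  calc _ ≤ ∫⁻ t in Ioc 0 h, pathEnergy u 0 T / ENNReal.ofReal h :=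
        setLIntegral_mono measurable_const key
    _ = pathEnergy u 0 T := by
        rw [setLIntegral_const, Real.volume_Ioc, sub_zero,
          ENNReal.div_mul_cancel hh0 ENNReal.ofReal_ne_top]

/-- Fatou's lemma along difference quotients with steps `T / (n + 1)`, which divide `T` evenly as
`lintegral_quotient_le_pathEnergy` requires. -/
theorem lintegral_deriv_le_pathEnergy {T : ℝ} (hT : 0 < T) (hc : Continuous u)
    (hac : AbsolutelyContinuousOnInterval u 0 T) (hu : ∀ t, T ≤ t → u t = u T) :
    ∫⁻ t in Ioc 0 T, ‖deriv u t‖ₑ ^ 2 ≤ pathEnergy u 0 T := by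
  let h : ℕ → ℝ := fun n => T / (n + 1)
  have hh : ∀ n, 0 < h n := fun n => by positivity
  have hlim : Tendsto h atTop (𝓝[≠] 0) := by
    refine tendsto_nhdsWithin_iff.2 ⟨?_, Eventually.of_forall fun n => (hh n).ne'⟩
    simpa [h, div_eq_mul_inv] using
      (tendsto_one_div_add_atTop_nhds_zero_nat (𝕜 := ℝ)).const_mul T
  let q : ℕ → ℝ → ℝ≥0∞ := fun n t => edist (u (t + h n)) (u t) ^ 2 / ENNReal.ofReal (h n) ^ 2
  have hq : ∀ n, Measurable (q n) := fun n => by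
    have : Measurable fun t : ℝ => edist (u (t + h n)) (u t) :=
      Continuous.measurable (by fun_prop)
    exact (this.pow_const 2).div_const _
  calc ∫⁻ t in Ioc 0 T, ‖deriv u t‖ₑ ^ 2
      ≤ ∫⁻ t in Ioc 0 T, liminf (fun n => q n t) atTop := by
        refine lintegral_mono_ae ?_
        have := ae_differentiableAt_of_absolutelyContinuousOnInterval hac
        rw [uIoc_of_le hT.le] at this
        filter_upwards [(ae_restrict_iff' measurableSet_Ioc).2 this] with t ht
        refine le_of_eq (Tendsto.liminf_eq ?_).symm
        have h1 := ((hasDerivAt_iff_tendsto_slope_zero.1 ht.hasDerivAt).comp hlim).enorm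
        refine ((ENNReal.Tendsto.pow (n := 2) h1).congr fun n => ?_)
        simp only [q, Function.comp_apply, enorm_smul, edist_eq_enorm_sub, mul_pow]
        rw [enorm_inv (hh n).ne', ← Real.enorm_of_nonneg (hh n).le, ENNReal.div_eq_inv_mul,
          ENNReal.inv_pow]
    _ ≤ liminf (fun n => ∫⁻ t in Ioc 0 T, q n t) atTop := lintegral_liminf_le hq
    _ ≤ pathEnergy u 0 T := by
        refine (liminf_le_liminf (v := fun _ => pathEnergy u 0 T)
          (Eventually.of_forall fun n => ?_)).trans_eq (liminf_const _)
        refine lintegral_quotient_le_pathEnergy hc hu (n := n + 1) (hh n) ?_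
        simp only [h]; push_cast; field_simp

end Derivative

/-! ### Lower semicontinuity and compact sublevels of the action -/

section Compactness

variable {T : ℝ} [hT : Fact (0 < T)]

theorem extendPath_of_ge {X : Type*} [TopologicalSpace X] (ω : PathSpace T X) {t : ℝ}
    (ht : T ≤ t) : extendPath ω t = extendPath ω T :=
  (IccExtend_of_right_le _ _ ht).trans (IccExtend_right _ _).symm

theorem continuous_extendPath {X : Type*} [TopologicalSpace X] (ω : PathSpace T X) :
    Continuous (extendPath ω) :=
  ω.continuous.comp continuous_projIcc

theorem continuous_extendPath_apply {X : Type*} [TopologicalSpace X] (t : ℝ) :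
    Continuous fun ω : PathSpace T X => extendPath ω t :=
  continuous_eval_const (projIcc 0 T hT.out.le t)

theorem lowerSemicontinuous_pathEnergy {X : Type*} [PseudoMetricSpace X] {W : Type*}
    [TopologicalSpace W] {F : W → ℝ → X} (hF : ∀ t, Continuous fun w => F w t) (a b : ℝ) :
    LowerSemicontinuous fun w => pathEnergy (F w) a b := by
  refine lowerSemicontinuous_iSup fun P => lowerSemicontinuous_iSup fun _ =>
    lowerSemicontinuous_sum fun i _ => Continuous.lowerSemicontinuous ?_
  rcases eq_or_ne (P.2 i).1 (P.2 i).2 with h | h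
  · simp only [h, edist_self, ne_eq, OfNat.ofNat_ne_zero, not_false_eq_true, zero_pow,
      ENNReal.zero_div]
    exact continuous_const
  · simp only [div_eq_mul_inv]
    refine ENNReal.continuous_mul_const (by simpa using h) |>.comp ?_
    exact (ENNReal.continuous_pow 2).comp ((hF _).edist (hF _))

/-- This replaces an integral of derivatives by a supremum of functions continuous in the path. A
path that is not absolutely continuous has infinite energy, so the two sides agree there as well. -/
theorem pathAction_eq_pathEnergy {d : ℕ} {D : Set (EuclideanSpace ℝ (Fin d))}
    (ω : PathSpace T D) :
    pathAction ω = ENNReal.ofReal T / 2 * pathEnergy (extendPath ω) 0 T := by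
  have hT0 : ENNReal.ofReal T ≠ 0 := by simpa using hT.out
  by_cases hac : AbsolutelyContinuousOnInterval (extendPath ω) 0 T
  · set u : ℝ → EuclideanSpace ℝ (Fin d) := fun s => (extendPath ω s : D) with hu
    have hac' : AbsolutelyContinuousOnInterval u 0 T := hac
    have hE : pathEnergy (extendPath ω) 0 T = pathEnergy u 0 T := rfl
    have hEq : ∫⁻ t in Ioc 0 T, ‖deriv u t‖ₑ ^ 2 = pathEnergy u 0 T := by
      refine le_antisymm (lintegral_deriv_le_pathEnergy hT.out
        (continuous_subtype_val.comp (continuous_extendPath ω)) hac'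
        fun t ht => congrArg Subtype.val (extendPath_of_ge ω ht)) ?_
      have := pathEnergy_le_lintegral_deriv hac'
      rwa [uIoc_of_le hT.out.le] at this
    rw [pathAction_eq_lintegral_deriv hac, hE, ← hEq, restrict_Ioc_eq_restrict_Icc]
    simp only [div_eq_mul_inv]
    rw [lintegral_mul_const' _ _ (by simp), mul_assoc, mul_comm (2⁻¹ : ℝ≥0∞)]
  · rw [pathAction, if_neg hac]
    by_contra h
    refine hac (absolutelyContinuousOnInterval_of_pathEnergy_ne_top fun h' => h ?_)
    rw [h', ENNReal.mul_top (ENNReal.div_pos hT0 (by simp)).ne']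

theorem lowerSemicontinuous_pathAction {d : ℕ} {D : Set (EuclideanSpace ℝ (Fin d))} :
    LowerSemicontinuous (pathAction : PathSpace T D → ℝ≥0∞) := by
  rw [show (pathAction : PathSpace T D → ℝ≥0∞) = (fun x => ENNReal.ofReal T / 2 * x) ∘
    fun ω => pathEnergy (extendPath ω) 0 T from funext pathAction_eq_pathEnergy]
  exact (ENNReal.continuous_const_mul (ENNReal.div_ne_top ENNReal.ofReal_ne_top
    two_ne_zero)).comp_lowerSemicontinuous
    (lowerSemicontinuous_pathEnergy continuous_extendPath_apply 0 T)
    fun _ _ h => by dsimp only; gcongr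

theorem isCompact_pathEnergy_le {X : Type*} [MetricSpace X] [CompactSpace X] {C : ℝ≥0∞}
    (hC : C ≠ ∞) : IsCompact {ω : PathSpace T X | pathEnergy (extendPath ω) 0 T ≤ C} := by
  -- Continuity is not imposed: it follows from finite energy. Thus `F` is a closed subset of a
  -- product of compact spaces, hence compact for pointwise convergence.
  let F : Set (Icc (0 : ℝ) T → X) := {f | pathEnergy (IccExtend hT.out.le f) 0 T ≤ C}
  have hequi : Equicontinuous fun (f : F) => (f : Icc (0 : ℝ) T → X) := by
    refine Metric.equicontinuous_of_continuity_modulus (fun r => √(C.toReal * r)) ?_ _ ?_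
    · have : Continuous fun r => √(C.toReal * r) := by fun_prop
      simpa using this.tendsto 0
    · intro s t f
      have h := edist_sq_le_pathEnergy_mul (IccExtend hT.out.le (f : Icc (0 : ℝ) T → X))
        (a := 0) (b := T) (s := s) (t := t)
        (by rw [uIcc_of_le hT.out.le]; exact s.2) (by rw [uIcc_of_le hT.out.le]; exact t.2)
      simp only [IccExtend_val] at h
      replace h := h.trans (mul_le_mul_left f.2 _)
      refine Real.le_sqrt_of_sq_le ?_
      have h' := ENNReal.toReal_mono (ENNReal.mul_ne_top hC (edist_ne_top _ _)) h
      simpa [ENNReal.toReal_mul, ENNReal.toReal_pow, ← dist_edist, Subtype.dist_eq] using h'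
  have hclosed : IsClosed F :=
    (lowerSemicontinuous_pathEnergy (F := fun f : Icc (0 : ℝ) T → X => IccExtend hT.out.le f)
      (fun t => continuous_apply (projIcc 0 T hT.out.le t)) 0 T).isClosed_preimage C
  refine ArzelaAscoli.isCompact_of_equicontinuous _ ?_ ?_
  · convert! hclosed.isCompact using 1
    ext f
    refine ⟨?_, fun hf => ⟨⟨f, hequi.continuous ⟨f, hf⟩⟩, hf, rfl⟩⟩
    rintro ⟨ω, hω, rfl⟩
    exact hω
  · exact hequi.comp fun ω : {ω : PathSpace T X | pathEnergy (extendPath ω) 0 T ≤ C} =>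
      (⟨ω.1, ω.2⟩ : F)

theorem isCompact_pathAction_le {d : ℕ} {D : Set (EuclideanSpace ℝ (Fin d))} (hD : IsCompact D)
    {C : ℝ≥0∞} (hC : C ≠ ∞) : IsCompact {ω : PathSpace T D | pathAction ω ≤ C} := by
  have := isCompact_iff_compactSpace.1 hD
  have hT0 : ENNReal.ofReal T / 2 ≠ 0 := by simpa using hT.out
  have hT1 : ENNReal.ofReal T / 2 ≠ ∞ := ENNReal.div_ne_top ENNReal.ofReal_ne_top two_ne_zero
  convert! isCompact_pathEnergy_le (T := T) (X := D) (ENNReal.div_ne_top hC hT0) using 3 with ω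
  rw [pathAction_eq_pathEnergy, ENNReal.le_div_iff_mul_le (Or.inl hT0) (Or.inl hT1), mul_comm]

end Compactness

/-- The superlevel sets are open, so the portmanteau theorem bounds their measures from below in the
limit; the layer-cake formula and Fatou's lemma integrate this over levels. First countability of
the space of measures makes Fatou available along `𝓝 ν₀`. -/
theorem lowerSemicontinuous_lintegral {Y : Type*} [TopologicalSpace Y] [HasOuterApproxClosed Y]
    [MeasurableSpace Y] [OpensMeasurableSpace Y] [FirstCountableTopology (ProbabilityMeasure Y)]
    {f : Y → ℝ≥0∞} (hf : LowerSemicontinuous f) :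
    LowerSemicontinuous fun ν : ProbabilityMeasure Y => ∫⁻ y, f y ∂(ν : Measure Y) := by
  -- Truncation at `n` gives finite values, so that levels can be real numbers; monotone convergence
  -- removes it at the end.
  have hopen : ∀ (n : ℕ) (t : ℝ), 0 < t → IsOpen {y | t < (min (f y) n).toReal} := by
    intro n t ht
    have : {y | t < (min (f y) n).toReal} = {y | ENNReal.ofReal t < f y} ∩ {_y | t < n} := by
      ext y
      have : min (f y) n ≠ ∞ := ((min_le_right _ _).trans_lt (ENNReal.natCast_lt_top n)).ne
      simp only [mem_ofPred_eq, mem_inter_iff]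
      rw [← ENNReal.ofReal_lt_iff_lt_toReal ht.le this, lt_min_iff,
        ENNReal.ofReal_lt_iff_lt_toReal ht.le (ENNReal.natCast_ne_top n), ENNReal.toReal_natCast]
    rw [this]
    exact (hf.isOpen_preimage _).inter isOpen_const
  have htrunc : ∀ (n : ℕ) (y : Y), ENNReal.ofReal (min (f y) n).toReal = min (f y) n :=
    fun n y => ENNReal.ofReal_toReal ((min_le_right _ _).trans_lt (ENNReal.natCast_lt_top n)).ne
  have hmeas : ∀ n : ℕ, Measurable fun y => min (f y) (n : ℝ≥0∞) := fun n =>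
    hf.measurable.min measurable_const
  have hn : ∀ n : ℕ, LowerSemicontinuous fun ν : ProbabilityMeasure Y =>
      ∫⁻ y, min (f y) n ∂(ν : Measure Y) := by
    intro n
    refine lowerSemicontinuous_iff_le_liminf.2 fun ν₀ => ?_
    have hcake : ∀ ν : ProbabilityMeasure Y, ∫⁻ y, min (f y) n ∂(ν : Measure Y) =
        ∫⁻ t in Ioi 0, (ν : Measure Y) {y | t < (min (f y) n).toReal} := by
      intro ν
      rw [← lintegral_eq_lintegral_meas_lt _ (Eventually.of_forall fun _ => ENNReal.toReal_nonneg)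
        (hmeas n).ennreal_toReal.aemeasurable]
      simp only [htrunc]
    simp only [hcake]
    calc _ ≤ ∫⁻ t in Ioi 0, liminf (fun ν : ProbabilityMeasure Y =>
          (ν : Measure Y) {y | t < (min (f y) n).toReal}) (𝓝 ν₀) :=
          setLIntegral_mono' measurableSet_Ioi fun t ht =>
            ProbabilityMeasure.le_liminf_measure_open_of_tendsto tendsto_id (hopen n t ht)
      _ ≤ _ := lintegral_liminf_le fun ν => Antitone.measurable fun s t hst =>
          measure_mono fun y (hy : t < _) => hst.trans_lt hy
  have hsup : ∀ ν : ProbabilityMeasure Y, ∫⁻ y, f y ∂(ν : Measure Y) =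
      ⨆ n : ℕ, ∫⁻ y, min (f y) n ∂(ν : Measure Y) := by
    intro ν
    rw [← lintegral_iSup hmeas fun m n hmn y => min_le_min_left _ (by exact_mod_cast hmn)]
    refine lintegral_congr fun y => ?_
    rw [← inf_iSup_eq, ENNReal.iSup_natCast, inf_top_eq]
  simp only [hsup]
  exact lowerSemicontinuous_iSup hn

/-! ### Compactness of flows and existence of minimizers -/

section Flows

theorem continuous_position {T : ℝ} {X : Type*} [TopologicalSpace X] (t : Icc (0 : ℝ) T) :
    Continuous fun p : PathSpace T X × X => p.1 t :=
  (continuous_eval_const t).comp continuous_fst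

variable {T : ℝ} {X : Type*} [MetricSpace X] [CompactSpace X] [MeasurableSpace X] [BorelSpace X]

/-- The joint law of the label and of the position at a given time. -/
def jointLaw (t : Icc (0 : ℝ) T) (ν : ProbabilityMeasure (PathSpace T X × X)) :
    ProbabilityMeasure (X × X) :=
  ν.map (continuous_snd.prodMk (continuous_position t)).aemeasurable

theorem continuous_jointLaw (t : Icc (0 : ℝ) T) : Continuous (jointLaw (X := X) t) :=
  ProbabilityMeasure.continuous_map (continuous_snd.prodMk (continuous_position t))

variable [hT : Fact (0 < T)]

theorem lowerSemicontinuous_flowAction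
    (hlsc : LowerSemicontinuous (pathAction : PathSpace T X → ℝ≥0∞)) :
    LowerSemicontinuous (flowAction : ProbabilityMeasure (PathSpace T X × X) → ℝ≥0∞) :=
  lowerSemicontinuous_lintegral (hlsc.comp continuous_fst)

/-- The incompressible flows with action at most `c`. -/
def boundedFlows (T : ℝ) [Fact (0 < T)] (μ : Measure X) (c : ℝ≥0∞) :
    Set (ProbabilityMeasure (PathSpace T X × X)) :=
  {ν | (ν : Measure (PathSpace T X × X)).map Prod.snd = μ ∧
    (∀ t : Icc (0 : ℝ) T, (ν : Measure (PathSpace T X × X)).map (fun p => p.1 t) = μ) ∧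
    flowAction ν ≤ c}

theorem isClosed_setOf_map_eq {Y Z : Type*} [TopologicalSpace Y] [MeasurableSpace Y]
    [OpensMeasurableSpace Y] [TopologicalSpace Z] [MeasurableSpace Z] [BorelSpace Z]
    [HasOuterApproxClosed Z] {f : Y → Z} (hf : Continuous f) (μ : Measure Z)
    [IsProbabilityMeasure μ] :
    IsClosed {ν : ProbabilityMeasure Y | (ν : Measure Y).map f = μ} := by
  let μ' : ProbabilityMeasure Z := ⟨μ, inferInstance⟩
  have h : {ν : ProbabilityMeasure Y | (ν : Measure Y).map f = μ} =
      {ν | ν.map hf.measurable.aemeasurable = μ'} := by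
    ext ν
    exact (Subtype.ext_iff (a1 := ν.map hf.measurable.aemeasurable) (a2 := μ')).symm
  rw [h]
  exact isClosed_eq (ProbabilityMeasure.continuous_map hf) continuous_const

/-- The constraints are closed under narrow convergence. Tightness comes from Markov's inequality:
outside the compact set of paths with action at most `M` the mass is at most `c / M`. -/
theorem isCompact_boundedFlows (μ : Measure X) [IsProbabilityMeasure μ]
    (hlsc : LowerSemicontinuous (pathAction : PathSpace T X → ℝ≥0∞))
    (hcpt : ∀ C ≠ ∞, IsCompact {ω : PathSpace T X | pathAction ω ≤ C}) {c : ℝ≥0∞} (hc : c ≠ ∞) :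
    IsCompact (boundedFlows T μ c) := by
  have hclosed : IsClosed (boundedFlows T μ c) := by
    have h : IsClosed {ν : ProbabilityMeasure (PathSpace T X × X) | ∀ t : Icc (0 : ℝ) T,
        (ν : Measure (PathSpace T X × X)).map (fun p => p.1 t) = μ} := by
      rw [ofPred_forall]
      exact isClosed_iInter fun t => isClosed_setOf_map_eq (continuous_position t) μ
    exact (isClosed_setOf_map_eq continuous_snd μ).inter
      (h.inter ((lowerSemicontinuous_flowAction hlsc).isClosed_preimage c))
  rw [← hclosed.closure_eq]
  refine isCompact_closure_of_isTightMeasureSet ?_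
  rw [isTightMeasureSet_iff_exists_isCompact_measure_compl_le]
  intro ε hε
  rcases eq_or_ne ε ∞ with rfl | hε'
  · exact ⟨∅, isCompact_empty, by simp⟩
  have hε0 : ε / 2 ≠ 0 := (ENNReal.half_pos hε.ne').ne'
  -- Chosen so that `c / M ≤ ε`; the `+ 1` keeps `M` positive when `c = 0`.
  set M := (c + 1) / ε with hM
  have hMtop : M ≠ ∞ := ENNReal.div_ne_top (by simp [hc]) hε.ne'
  have hM0 : M ≠ 0 := (ENNReal.div_pos (by simp) hε').ne'
  refine ⟨{ω : PathSpace T X | pathAction ω ≤ M} ×ˢ univ, (hcpt M hMtop).prod isCompact_univ, ?_⟩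
  rintro _ ⟨ν, hν, rfl⟩
  have hmeas : Measurable fun p : PathSpace T X × X => pathAction p.1 :=
    hlsc.measurable.comp measurable_fst
  have h := mul_meas_ge_le_lintegral (μ := (ν : Measure (PathSpace T X × X))) hmeas M
  have h2 : (ν : Measure (PathSpace T X × X)) {p | M ≤ pathAction p.1} ≤ c / M := by
    rw [ENNReal.le_div_iff_mul_le (Or.inl hM0) (Or.inl hMtop), mul_comm]
    exact h.trans hν.2.2
  refine (measure_mono fun p hp => ?_).trans (h2.trans ?_)
  · simp only [mem_compl_iff, mem_prod, mem_ofPred_eq, mem_univ, and_true, not_le] at hp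
    exact hp.le
  · rw [ENNReal.div_le_iff hM0 hMtop, hM, ENNReal.mul_div_cancel hε.ne' hε']
    exact le_self_add

theorem isGenFlow_iff {μ : Measure X} {η γ : ProbabilityMeasure (X × X)}
    {ν : ProbabilityMeasure (PathSpace T X × X)} :
    IsGenFlow T μ η γ ν ↔ (ν : Measure (PathSpace T X × X)).map Prod.snd = μ ∧
      (∀ t : Icc (0 : ℝ) T, (ν : Measure (PathSpace T X × X)).map (fun p => p.1 t) = μ) ∧
      jointLaw (startTime T) ν = η ∧ jointLaw (endTime T) ν = γ := by
  constructor
  · rintro ⟨h1, h2, h3, h4⟩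
    exact ⟨h1, h2, Subtype.ext h3, Subtype.ext h4⟩
  · rintro ⟨h1, h2, h3, h4⟩
    exact ⟨h1, h2, congrArg Subtype.val h3, congrArg Subtype.val h4⟩

theorem exists_isGenFlow_flowAction_eq (μ : Measure X) [IsProbabilityMeasure μ]
    (hlsc : LowerSemicontinuous (pathAction : PathSpace T X → ℝ≥0∞))
    (hcpt : ∀ C ≠ ∞, IsCompact {ω : PathSpace T X | pathAction ω ≤ C})
    (η γ : ProbabilityMeasure (X × X))
    (hex : ∃ ν : ProbabilityMeasure (PathSpace T X × X), IsGenFlow T μ η γ ν) :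
    ∃ ν : ProbabilityMeasure (PathSpace T X × X),
      IsGenFlow T μ η γ ν ∧ flowAction ν = relaxedDistSq T μ η γ := by
  by_cases hfin : ∃ ν : ProbabilityMeasure (PathSpace T X × X),
      IsGenFlow T μ η γ ν ∧ flowAction ν ≠ ∞
  · obtain ⟨ν₀, h₀, hf₀⟩ := hfin
    set K : Set (ProbabilityMeasure (PathSpace T X × X)) := boundedFlows T μ (flowAction ν₀) ∩
      {ν | jointLaw (startTime T) ν = η ∧ jointLaw (endTime T) ν = γ}
    have hK : IsCompact K := (isCompact_boundedFlows μ hlsc hcpt hf₀).inter_right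
      ((isClosed_eq (continuous_jointLaw _) continuous_const).inter
        (isClosed_eq (continuous_jointLaw _) continuous_const))
    have hmem : ∀ ν, IsGenFlow T μ η γ ν → flowAction ν ≤ flowAction ν₀ → ν ∈ K := by
      intro ν hν hle
      obtain ⟨h1, h2, h3⟩ := isGenFlow_iff.1 hν
      exact ⟨⟨h1, h2, hle⟩, h3⟩
    obtain ⟨ν, hν, hmin⟩ := LowerSemicontinuousOn.exists_isMinOn ⟨ν₀, hmem ν₀ h₀ le_rfl⟩ hK
      ((lowerSemicontinuous_flowAction hlsc).lowerSemicontinuousOn K)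
    have hgen : IsGenFlow T μ η γ ν := isGenFlow_iff.2 ⟨hν.1.1, hν.1.2.1, hν.2⟩
    refine ⟨ν, hgen, le_antisymm (le_iInf₂ fun ν' hν' => ?_) (iInf₂_le ν hgen)⟩
    rcases le_total (flowAction ν') (flowAction ν₀) with h | h
    · exact isMinOn_iff.1 hmin ν' (hmem ν' hν' h)
    · exact hν.1.2.2.trans h
  -- If every competitor has infinite action, any of them is a minimizer.
  · push Not at hfin
    obtain ⟨ν, hν⟩ := hex
    refine ⟨ν, hν, ?_⟩
    rw [hfin ν hν, eq_comm]
    exact iInf₂_eq_top.2 hfin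

/-- Because the infimum is attained, the pairs at distance at most `c` are exactly the endpoint laws
of incompressible flows with action at most `c²`: a continuous image of a compact set, hence closed.
-/
theorem lowerSemicontinuous_relaxedDist (μ : Measure X) [IsProbabilityMeasure μ]
    (hlsc : LowerSemicontinuous (pathAction : PathSpace T X → ℝ≥0∞))
    (hcpt : ∀ C ≠ ∞, IsCompact {ω : PathSpace T X | pathAction ω ≤ C}) :
    LowerSemicontinuous fun p : ProbabilityMeasure (X × X) × ProbabilityMeasure (X × X) =>
      relaxedDist T μ p.1 p.2 := by
  rw [lowerSemicontinuous_iff_isClosed_preimage]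
  intro c
  rcases eq_or_ne c ∞ with rfl | hc
  · simp
  have hc2 : c ^ 2 ≠ ∞ := ENNReal.pow_ne_top hc
  have himage := ((isCompact_boundedFlows μ hlsc hcpt hc2).image
    ((continuous_jointLaw (X := X) (startTime T)).prodMk
      (continuous_jointLaw (X := X) (endTime T)))).isClosed
  convert! himage using 1
  ext ⟨η, γ⟩
  have hpow : relaxedDist T μ η γ ≤ c ↔ relaxedDistSq T μ η γ ≤ c ^ 2 := by
    rw [relaxedDist, one_div, ENNReal.rpow_inv_le_iff two_pos, ENNReal.rpow_two]
  simp only [mem_preimage, mem_Iic, hpow, mem_image, Prod.mk.injEq]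
  constructor
  · intro h
    have hex : ∃ ν : ProbabilityMeasure (PathSpace T X × X), IsGenFlow T μ η γ ν := by
      by_contra hno
      push Not at hno
      refine hc2 (top_le_iff.1 (le_trans (le_of_eq ?_) h))
      exact (iInf₂_eq_top.2 fun ν hν => absurd hν (hno ν)).symm
    obtain ⟨ν, hν, hact⟩ := exists_isGenFlow_flowAction_eq μ hlsc hcpt η γ hex
    obtain ⟨h1, h2, h3⟩ := isGenFlow_iff.1 hν
    exact ⟨ν, ⟨h1, h2, hact.trans_le h⟩, h3⟩
  · rintro ⟨ν, hν, h3⟩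
    exact (iInf₂_le ν (isGenFlow_iff.2 ⟨hν.1, hν.2.1, h3⟩)).trans hν.2.2

theorem lowerSemicontinuous_relaxedDist_plans (μ : Measure X) [IsProbabilityMeasure μ]
    (hlsc : LowerSemicontinuous (pathAction : PathSpace T X → ℝ≥0∞))
    (hcpt : ∀ C ≠ ∞, IsCompact {ω : PathSpace T X | pathAction ω ≤ C}) :
    LowerSemicontinuous fun p : plans μ × plans μ =>
      relaxedDist T μ (p.1 : ProbabilityMeasure (X × X)) (p.2 : ProbabilityMeasure (X × X)) := by
  have hval : Continuous fun p : plans μ × plans μ =>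
      ((p.1 : ProbabilityMeasure (X × X)), (p.2 : ProbabilityMeasure (X × X))) :=
    (continuous_subtype_val.comp continuous_fst).prodMk
      (continuous_subtype_val.comp continuous_snd)
  have h := LowerSemicontinuous.comp (lowerSemicontinuous_relaxedDist (T := T) μ hlsc hcpt) hval
  exact h

end Flows

/-! ### Comparison with the Arnold distance -/

section Arnold

variable {T : ℝ} [hT : Fact (0 < T)] {d : ℕ} {D : Set (EuclideanSpace ℝ (Fin d))}

theorem pathAction_of_contDiff (ω : PathSpace T D) {v : ℝ → EuclideanSpace ℝ (Fin d)}
    (hv : ContDiff ℝ 1 v) (hω : ∀ t : Icc (0 : ℝ) T, (ω t : EuclideanSpace ℝ (Fin d)) = v t) :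
    pathAction ω = ENNReal.ofReal T * ∫⁻ t in Icc (0 : ℝ) T, ‖deriv v t‖ₑ ^ 2 / 2 := by
  set u : ℝ → EuclideanSpace ℝ (Fin d) := fun s => (extendPath ω s : D) with hu
  have huv : EqOn u v (Icc 0 T) := fun t ht => by
    have : extendPath ω t = ω ⟨t, ht⟩ := IccExtend_of_mem _ _ ht
    change ((extendPath ω t : D) : EuclideanSpace ℝ (Fin d)) = v t; rw [this, hω ⟨t, ht⟩]
  have hac : AbsolutelyContinuousOnInterval u 0 T := by
    refine ContDiffOn.absolutelyContinuousOnInterval ?_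
    rw [uIcc_of_le hT.out.le]
    exact hv.contDiffOn.congr huv
  rw [pathAction_eq_lintegral_deriv hac, ← restrict_Ioo_eq_restrict_Icc]
  congr 1
  refine setLIntegral_congr_fun measurableSet_Ioo fun t ht => ?_
  have : u =ᶠ[𝓝 t] v := huv.eventuallyEq_of_mem (Icc_mem_nhds ht.1 ht.2)
  rw [this.deriv_eq]

theorem relaxedDistSq_le_arnoldAction (hD : IsCompact D) (μ : Measure D) [IsProbabilityMeasure μ]
    {f h : D ≃ₜ D} {g : ℝ → (D ≃ₜ D)} (hf : f = Homeomorph.refl D)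
    (hg : IsSmoothCurve T μ f h g) :
    relaxedDistSq T μ (planOfMap μ id) (planOfMap μ h) ≤ arnoldAction T μ g := by
  have := isCompact_iff_compactSpace.1 hD
  obtain ⟨G, hG, hGg⟩ := hg.smooth
  let F : C(D × Icc (0 : ℝ) T, D) :=
    { toFun := fun p => g p.2 p.1
      continuous_toFun := by
        refine continuous_induced_rng.2 ?_
        have h1 : Continuous fun p : D × Icc (0 : ℝ) T => G ((p.2 : ℝ), (p.1 : _)) :=
          hG.continuous.comp (by fun_prop)
        exact h1.congr fun p => hGg p.2 p.2.2 p.1 }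
  have hF : Continuous fun x : D => (F.curry x, x) := F.curry.continuous.prodMk continuous_id
  -- The law of (trajectory of `x`, `x`) when `x` has law `μ`.
  let ν : ProbabilityMeasure (PathSpace T D × D) :=
    ⟨μ.map fun x => (F.curry x, x), Measure.isProbabilityMeasure_map hF.aemeasurable⟩
  have hν : (ν : Measure (PathSpace T D × D)) = μ.map fun x => (F.curry x, x) := rfl
  have hmap : ∀ {Z : Type} [TopologicalSpace Z] [MeasurableSpace Z] [BorelSpace Z]
      {k : PathSpace T D × D → Z}, Continuous k →
      (ν : Measure (PathSpace T D × D)).map k = μ.map fun x => k (F.curry x, x) := by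
    intro Z _ _ _ k hk
    rw [hν, Measure.map_map hk.measurable hF.measurable]
    rfl
  have hflow : IsGenFlow T μ (planOfMap μ id) (planOfMap μ h) ν := by
    refine ⟨?_, fun t => ?_, ?_, ?_⟩
    · rw [hmap continuous_snd]; exact Measure.map_id
    · rw [hmap (continuous_position t)]; exact (hg.mem_sdiff t t.2).2.2
    · rw [hmap (continuous_snd.prodMk (continuous_position _)), planOfMap]
      congr 1
      ext1 x
      change (x, g 0 x) = _
      rw [hg.initial, hf]; rfl
    · rw [hmap (continuous_snd.prodMk (continuous_position _)), planOfMap]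
      congr 1
      ext1 x
      change (x, g T x) = _
      rw [hg.final]
  -- The time derivative of the smooth extension serves both actions: it gives the velocity of each
  -- path and the one-sided derivatives at the endpoints in `arnoldAction`. Its continuity allows
  -- the exchange of integrals.
  let V : ℝ → EuclideanSpace ℝ (Fin d) → EuclideanSpace ℝ (Fin d) := fun t x =>
    fderiv ℝ G (t, x) (1, 0)
  have hV : ∀ (x : EuclideanSpace ℝ (Fin d)) (t : ℝ),
      HasDerivAt (fun s => G (s, x)) (V t x) t := fun x t =>
    ((hG.differentiable (by simp) (t, x)).hasFDerivAt.comp_hasDerivAt t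
      ((hasDerivAt_id t).prodMk (hasDerivAt_const t x)))
  have hVc : Continuous fun p : ℝ × D => V p.1 p.2 := by
    have h1 : Continuous (fderiv ℝ G) := hG.continuous_fderiv (by simp)
    exact (h1.comp (by fun_prop : Continuous fun p : ℝ × D =>
      (p.1, (p.2 : EuclideanSpace ℝ (Fin d))))).clm_apply continuous_const
  calc relaxedDistSq T μ (planOfMap μ id) (planOfMap μ h) ≤ flowAction ν := iInf₂_le ν hflow
    _ ≤ ∫⁻ x, pathAction (F.curry x) ∂μ := lintegral_map_le _ _
    _ = ∫⁻ x : D, ENNReal.ofReal T * (∫⁻ t in Icc (0 : ℝ) T, ‖V t x‖ₑ ^ 2 / 2) ∂μ := by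
        refine lintegral_congr fun x => ?_
        rw [pathAction_of_contDiff (F.curry x) (v := fun t => G (t, (x : _)))
          ((hG.of_le (by exact_mod_cast le_top)).comp (by fun_prop))
          fun t => (hGg t t.2 x).symm]
        simp only [(hV _ _).deriv]
    _ = ENNReal.ofReal T * ∫⁻ t in Icc (0 : ℝ) T, ∫⁻ x : D, ‖V t x‖ₑ ^ 2 / 2 ∂μ := by
        rw [lintegral_const_mul' _ _ ENNReal.ofReal_ne_top, lintegral_lintegral_swap]
        have h2 : Continuous fun p : D × ℝ => V p.2 p.1 := hVc.comp continuous_swap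
        exact ((h2.measurable.enorm.pow_const 2).div_const 2).aemeasurable
    _ = arnoldAction T μ g := by
        rw [arnoldAction]
        congr 1
        refine setLIntegral_congr_fun measurableSet_Icc fun t ht => ?_
        refine lintegral_congr fun x => ?_
        have h3 : derivWithin (fun s => (g s x : EuclideanSpace ℝ (Fin d))) (Icc (0 : ℝ) T) t =
            V t x := by
          rw [derivWithin_congr (fun s hs => (hGg s hs x).symm) (hGg t ht x).symm]
          exact (hV x t).hasDerivWithinAt.derivWithin (uniqueDiffOn_Icc hT.out t ht)
        rw [h3]

theorem relaxedDist_le_arnoldDist (hD : IsCompact D) (μ : Measure D) [IsProbabilityMeasure μ]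
    (h : D ≃ₜ D) : relaxedDist T μ (planOfMap μ id) (planOfMap μ h) ≤
      arnoldDist T μ (Homeomorph.refl D) h :=
  ENNReal.rpow_le_rpow (le_iInf₂ fun _ hg => relaxedDistSq_le_arnoldAction hD μ rfl hg)
    (by norm_num)

end Arnold

/-! ### Gluing of measures and lifting of plans -/

section Gluing

variable {X X' Y : Type*} [MeasurableSpace X] [MeasurableSpace X'] [MeasurableSpace Y]

/-- Given `y` with law `γ`, the second component is drawn from the conditional law of `ρ` given the
value `p y`. -/
theorem exists_gluing [StandardBorelSpace X'] [Nonempty X'] (γ : Measure Y)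
    [IsProbabilityMeasure γ] {p : Y → X} (hp : Measurable p) (ρ : Measure (X × X'))
    [IsProbabilityMeasure ρ] (h : γ.map p = ρ.map Prod.fst) :
    ∃ π : Measure (Y × X'), IsProbabilityMeasure π ∧ π.map Prod.fst = γ ∧
      π.map (fun z => (p z.1, z.2)) = ρ := by
  refine ⟨γ ⊗ₘ ρ.condKernel.comap p hp, inferInstance, Measure.fst_compProd _ _, ?_⟩
  have hpm : Measurable fun z : Y × X' => (p z.1, z.2) :=
    (hp.comp measurable_fst).prodMk measurable_snd
  ext s hs
  have hdis : ρ.fst ⊗ₘ ρ.condKernel = ρ := ρ.disintegrate _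
  have hs' : ρ s = ∫⁻ x, ρ.condKernel x (Prod.mk x ⁻¹' s) ∂ρ.fst := by
    rw [← Measure.compProd_apply hs, hdis]
  rw [Measure.map_apply hpm hs, Measure.compProd_apply (hpm hs), hs', Measure.fst, ← h,
    lintegral_map (ProbabilityTheory.Kernel.measurable_kernel_prodMk_left hs) hp]
  rfl

/-- For `(x, y)` with law `γ`, random preimages of `x` and then of `y` under `f` are drawn by gluing
twice with `ρ`, the law of `(f x', x')`. Each preimage has law `μ'`, and `f` sends the pair back to
`(x, y)` almost surely because `ρ` is carried by the graph. -/
theorem exists_plan_map_eq [StandardBorelSpace X'] [MeasurableEq X] {μ : Measure X}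
    {μ' : Measure X'} [IsProbabilityMeasure μ'] {f : X' → X} (hf : Measurable f)
    (hμ : μ'.map f = μ) {γ : ProbabilityMeasure (X × X)} (hγ : γ ∈ plans μ) :
    ∃ γ' ∈ plans μ', (γ' : Measure (X' × X')).map (Prod.map f f) = γ := by
  have : Nonempty X' := nonempty_of_isProbabilityMeasure μ'
  have hgraph : Measurable fun x' : X' => (f x', x') := hf.prodMk measurable_id
  let ρ : Measure (X × X') := μ'.map fun x' => (f x', x')
  have : IsProbabilityMeasure ρ := Measure.isProbabilityMeasure_map hgraph.aemeasurable
  have hρ1 : ρ.map Prod.fst = μ := by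
    rw [Measure.map_map measurable_fst hgraph, ← hμ]; rfl
  have hρ2 : ρ.map Prod.snd = μ' := by
    rw [Measure.map_map measurable_snd hgraph]; exact Measure.map_id
  have hset : MeasurableSet {w : X × X' | f w.2 = w.1} :=
    measurableSet_eq_fun (hf.comp measurable_snd) measurable_fst
  have hρ : ∀ᵐ w ∂ρ, f w.2 = w.1 := by
    rw [ae_map_iff hgraph.aemeasurable hset]; simp
  obtain ⟨π₁, _, h1, h1'⟩ := exists_gluing (γ : Measure (X × X)) measurable_fst ρ
    (hγ.1.trans hρ1.symm)
  obtain ⟨π₂, _, h2, h2'⟩ := exists_gluing π₁ (p := fun z => z.1.2) (by fun_prop) ρ (by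
    rw [hρ1, ← hγ.2, ← h1, Measure.map_map measurable_snd measurable_fst]; rfl)
  have hm1 : Measurable fun z : ((X × X) × X') × X' => (z.1.1.1, z.1.2) := by fun_prop
  have hm2 : Measurable fun z : ((X × X) × X') × X' => (z.1.1.2, z.2) := by fun_prop
  have hm : Measurable fun z : ((X × X) × X') × X' => (z.1.2, z.2) := by fun_prop
  have hl1 : π₂.map (fun z => (z.1.1.1, z.1.2)) = ρ := by
    rw [← h1', ← h2, Measure.map_map (by fun_prop) measurable_fst]; rfl
  have ha1 : ∀ᵐ z ∂π₂, f z.1.2 = z.1.1.1 := by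
    rw [← hl1, ae_map_iff hm1.aemeasurable hset] at hρ; exact hρ
  have ha2 : ∀ᵐ z ∂π₂, f z.2 = z.1.1.2 := by
    rw [← h2', ae_map_iff hm2.aemeasurable hset] at hρ; exact hρ
  refine ⟨⟨π₂.map fun z => (z.1.2, z.2), Measure.isProbabilityMeasure_map hm.aemeasurable⟩,
    ⟨?_, ?_⟩, ?_⟩
  · change (π₂.map fun z => (z.1.2, z.2)).map Prod.fst = μ'
    rw [Measure.map_map measurable_fst hm, ← hρ2, ← hl1, Measure.map_map measurable_snd hm1]
    rfl
  · change (π₂.map fun z => (z.1.2, z.2)).map Prod.snd = μ'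
    rw [Measure.map_map measurable_snd hm, ← hρ2, ← h2', Measure.map_map measurable_snd hm2]
    rfl
  · change (π₂.map fun z => (z.1.2, z.2)).map (Prod.map f f) = γ
    rw [Measure.map_map (hf.prodMap hf) hm, ← h1, ← h2,
      Measure.map_map measurable_fst measurable_fst]
    refine Measure.map_congr ?_
    filter_upwards [ha1, ha2] with z hz1 hz2
    exact Prod.ext hz1 hz2

end Gluing

/-! ### Transport of flows by Lipschitz maps -/

section Transfer

theorem speed_comp_le {X X' : Type*} [PseudoMetricSpace X] [PseudoMetricSpace X'] {f : X' → X}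
    {K : ℝ≥0} (hf : LipschitzWith K f) (u : ℝ → X') (t : ℝ) :
    speed (f ∘ u) t ≤ K * speed u t := by
  rw [speed, speed, ← ENNReal.limsup_const_mul_of_ne_top ENNReal.coe_ne_top]
  refine limsup_le_limsup (Eventually.of_forall fun s => ?_)
  dsimp only
  rw [← mul_div_assoc]
  exact ENNReal.div_le_div_right (hf _ _) _

theorem measurable_position {T : ℝ} {X : Type*} [TopologicalSpace X] [MeasurableSpace X]
    [BorelSpace X] (t : Icc (0 : ℝ) T) :
    Measurable fun p : PathSpace T X × X => p.1 t :=
  (continuous_eval_const t).measurable.comp measurable_fst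

theorem measurable_label_position {T : ℝ} {X : Type*} [TopologicalSpace X] [MeasurableSpace X]
    [BorelSpace X] (t : Icc (0 : ℝ) T) :
    Measurable fun p : PathSpace T X × X => (p.2, p.1 t) :=
  measurable_snd.prodMk (measurable_position t)

variable {T : ℝ} [hT : Fact (0 < T)]

theorem pathAction_comp_le {X X' : Type*} [PseudoMetricSpace X] [PseudoMetricSpace X']
    (f : C(X', X)) {K : ℝ≥0} (hK : K ≠ 0) (hf : LipschitzWith K f) (ω : PathSpace T X') :
    pathAction (f.comp ω) ≤ K ^ 2 * pathAction ω := by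
  have hext : extendPath (f.comp ω) = f ∘ extendPath ω := rfl
  by_cases h : AbsolutelyContinuousOnInterval (extendPath ω) 0 T
  · rw [pathAction, if_pos (hext ▸ hf.comp_absolutelyContinuousOnInterval h), pathAction,
      if_pos h, mul_left_comm, ← lintegral_const_mul' ((K : ℝ≥0∞) ^ 2) _ (by simp)]
    refine mul_le_mul_right (lintegral_mono fun t => ?_) _
    rw [← mul_div_assoc, ← mul_pow, hext]
    exact ENNReal.div_le_div_right (pow_le_pow_left' (speed_comp_le hf _ t) 2) _
  · rw [pathAction.eq_def ω, if_neg h, ENNReal.mul_top (by simpa using hK)]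
    exact le_top

variable {X X' : Type*} [MetricSpace X] [MeasurableSpace X] [BorelSpace X]
  [MetricSpace X'] [MeasurableSpace X'] [BorelSpace X']

theorem relaxedDistSq_map_le {μ : Measure X} {μ' : Measure X'} {f : X' → X} {K : ℝ≥0}
    (hK : K ≠ 0) (hf : LipschitzWith K f) (hμ : μ'.map f = μ) (η γ : Measure (X' × X')) :
    relaxedDistSq T μ (η.map (Prod.map f f)) (γ.map (Prod.map f f)) ≤
      K ^ 2 * relaxedDistSq T μ' η γ := by
  have hK0 : (K : ℝ≥0∞) ^ 2 ≠ 0 := by simpa using hK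
  have hK1 : (K : ℝ≥0∞) ^ 2 ≠ ∞ := by simp
  rw [mul_comm, ← ENNReal.div_le_iff hK0 hK1]
  refine le_iInf₂ fun ν hν => ?_
  rw [ENNReal.div_le_iff hK0 hK1, mul_comm]
  let F : C(X', X) := ⟨f, hf.continuous⟩
  have hfm : Measurable f := hf.continuous.measurable
  -- Labels are moved by `f` together with the paths, so the joint laws of label and position are
  -- pushed by `f × f`.
  let Φ : PathSpace T X' × X' → PathSpace T X × X := Prod.map F.comp f
  have hΦ : Measurable Φ := (ContinuousMap.continuous_postcomp F).measurable.prodMap hfm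
  let ν₁ : ProbabilityMeasure (PathSpace T X × X) := ν.map hΦ.aemeasurable
  have hν₁ : (ν₁ : Measure (PathSpace T X × X)) = (ν : Measure _).map Φ := rfl
  have hff : Measurable (Prod.map f f) := hfm.prodMap hfm
  have hflow : IsGenFlow T μ (η.map (Prod.map f f)) (γ.map (Prod.map f f)) ν₁ := by
    refine ⟨?_, fun t => ?_, ?_, ?_⟩
    · rw [hν₁, Measure.map_map measurable_snd hΦ, ← hμ, ← hν.label,
        Measure.map_map hfm measurable_snd]
      rfl
    · rw [hν₁, Measure.map_map (measurable_position t) hΦ, ← hμ, ← hν.incompressible t,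
        Measure.map_map hfm (measurable_position t)]
      rfl
    · rw [hν₁, Measure.map_map (measurable_label_position _) hΦ, ← hν.initial,
        Measure.map_map hff (measurable_label_position _)]
      rfl
    · rw [hν₁, Measure.map_map (measurable_label_position _) hΦ, ← hν.final,
        Measure.map_map hff (measurable_label_position _)]
      rfl
  calc _ ≤ flowAction ν₁ := iInf₂_le ν₁ hflow
    _ = ∫⁻ p, pathAction p.1 ∂(ν : Measure (PathSpace T X' × X')).map Φ := rfl
    -- This direction of the change of variables holds without measurability of `pathAction`.
    _ ≤ ∫⁻ p, pathAction (F.comp p.1) ∂(ν : Measure (PathSpace T X' × X')) :=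
        lintegral_map_le (fun p : PathSpace T X × X => pathAction p.1) Φ
    _ ≤ ∫⁻ p, K ^ 2 * pathAction p.1 ∂(ν : Measure (PathSpace T X' × X')) :=
        lintegral_mono fun p => pathAction_comp_le F hK hf p.1
    _ = K ^ 2 * flowAction ν := lintegral_const_mul' _ _ hK1

theorem relaxedDist_map_le {μ : Measure X} {μ' : Measure X'} {f : X' → X} {K : ℝ≥0}
    (hK : K ≠ 0) (hf : LipschitzWith K f) (hμ : μ'.map f = μ) (η γ : Measure (X' × X')) :
    relaxedDist T μ (η.map (Prod.map f f)) (γ.map (Prod.map f f)) ≤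
      K * relaxedDist T μ' η γ := by
  have h := ENNReal.rpow_le_rpow (relaxedDistSq_map_le (T := T) hK hf hμ η γ)
    (show (0 : ℝ) ≤ 1 / 2 by norm_num)
  rwa [ENNReal.mul_rpow_of_nonneg _ _ (by norm_num), ← ENNReal.rpow_natCast, ← ENNReal.rpow_mul,
    show ((2 : ℕ) : ℝ) * (1 / 2) = 1 by norm_num, ENNReal.rpow_one] at h

/-- Needed for `K = 0`. The only plan is the Dirac mass at `(x, x)`, and the stationary path has
zero action. -/
theorem relaxedDist_dirac (x : X) {γ : ProbabilityMeasure (X × X)}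
    (hγ : γ ∈ plans (Measure.dirac x)) :
    relaxedDist T (Measure.dirac x) (planOfMap (Measure.dirac x) id) γ = 0 := by
  let p : PathSpace T X × X := (ContinuousMap.const _ x, x)
  let ν : ProbabilityMeasure (PathSpace T X × X) := ⟨Measure.dirac p, inferInstance⟩
  have hν : (ν : Measure (PathSpace T X × X)) = Measure.dirac p := rfl
  have hγx : (γ : Measure (X × X)) = Measure.dirac (x, x) := by
    have h1 : ∀ᵐ z ∂(γ : Measure (X × X)), z.1 = x := by
      have : ∀ᵐ y ∂(γ : Measure (X × X)).map Prod.fst, y = x := by rw [hγ.1]; simp [ae_dirac_eq]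
      exact ae_of_ae_map measurable_fst.aemeasurable this
    have h2 : ∀ᵐ z ∂(γ : Measure (X × X)), z.2 = x := by
      have : ∀ᵐ y ∂(γ : Measure (X × X)).map Prod.snd, y = x := by rw [hγ.2]; simp [ae_dirac_eq]
      exact ae_of_ae_map measurable_snd.aemeasurable this
    have h3 : (id : X × X → X × X) =ᵐ[(γ : Measure (X × X))] fun _ => (x, x) := by
      filter_upwards [h1, h2] with z hz1 hz2 using Prod.ext hz1 hz2
    have h4 : (γ : Measure (X × X)).map id = (γ : Measure (X × X)).map fun _ => (x, x) :=
      Measure.map_congr h3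
    rwa [Measure.map_id, Measure.map_const, measure_univ, one_smul] at h4
  have hflow : IsGenFlow T (Measure.dirac x) (planOfMap (Measure.dirac x) id) γ ν := by
    refine ⟨?_, fun t => ?_, ?_, ?_⟩
    · rw [hν, Measure.map_dirac' measurable_snd]
    · rw [hν, Measure.map_dirac' (measurable_position t)]; rfl
    · rw [hν, Measure.map_dirac' (measurable_label_position _), planOfMap,
        Measure.map_dirac' (by fun_prop)]
      rfl
    · rw [hν, Measure.map_dirac' (measurable_label_position _), hγx]; rfl
  have hact : flowAction ν = 0 := by
    have hext : extendPath (ContinuousMap.const (Icc (0 : ℝ) T) x) = fun _ => x := rfl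
    rw [flowAction, hν, lintegral_dirac, pathAction, if_pos]
    · simp [p, hext, speed]
    · rw [hext]
      exact ((LipschitzWith.const x).lipschitzOnWith (s := uIcc 0 T)).absolutelyContinuousOnInterval
  have hzero : relaxedDistSq T (Measure.dirac x) (planOfMap (Measure.dirac x) id) γ = 0 :=
    nonpos_iff_eq_zero.1 ((iInf₂_le ν hflow).trans_eq hact)
  rw [relaxedDist, hzero]
  simp

theorem iSup_relaxedDist_le_mul [CompactSpace X] [CompactSpace X'] {μ : Measure X}
    {μ' : Measure X'} [IsProbabilityMeasure μ'] {f : X' → X} {K : ℝ≥0} (hf : LipschitzWith K f)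
    (hμ : μ'.map f = μ) :
    (⨆ γ ∈ plans μ, relaxedDist T μ (planOfMap μ id) γ) ≤
      K * (⨆ γ' ∈ plans μ', relaxedDist T μ' (planOfMap μ' id) γ') := by
  have hfm : Measurable f := hf.continuous.measurable
  refine iSup₂_le fun γ hγ => ?_
  -- The right side is zero here, even if the supremum is infinite, so the left side must vanish:
  -- `f` is constant and `μ` is a Dirac mass.
  rcases eq_or_ne K 0 with rfl | hK
  · obtain ⟨x'⟩ := nonempty_of_isProbabilityMeasure μ'
    have hconst : f = fun _ => f x' := by
      funext y
      simpa using hf y x'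
    have : μ = Measure.dirac (f x') := by
      rw [← hμ, hconst, Measure.map_const, measure_univ, one_smul]
    subst this
    rw [relaxedDist_dirac _ hγ]
    exact zero_le
  · obtain ⟨γ', hγ', hmap⟩ := exists_plan_map_eq hfm hμ hγ
    have hid : planOfMap μ id = (planOfMap μ' id).map (Prod.map f f) := by
      rw [planOfMap, planOfMap, Measure.map_map (hfm.prodMap hfm) (by fun_prop), ← hμ,
        Measure.map_map (by fun_prop) hfm]
      rfl
    rw [hid, ← hmap]
    refine (relaxedDist_map_le hK hf hμ _ _).trans ?_
    gcongr
    exact le_iSup₂_of_le (f := fun γ' (_ : γ' ∈ plans μ') =>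
      relaxedDist T μ' (planOfMap μ' id) γ') γ' hγ' le_rfl

end Transfer

/-! ### Action of paths that are Lipschitz on each half -/

section PiecewiseLipschitz

variable {T : ℝ} [hT : Fact (0 < T)]

theorem speed_le_of_lipschitzOnWith {X : Type*} [PseudoMetricSpace X] {u : ℝ → X} {K : ℝ≥0}
    {S : Set ℝ} {t : ℝ} (hu : LipschitzOnWith K u S) (hS : S ∈ 𝓝 t) : speed u t ≤ K := by
  refine limsup_le_of_le (by isBoundedDefault) ?_
  filter_upwards [mem_nhdsWithin_of_mem_nhds hS] with s hs
  exact ENNReal.div_le_of_le_mul (hu hs (mem_of_mem_nhds hS))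

/-- Each half contributes `T · (T/2) · K²/2`. The Lipschitz bounds agree at `T / 2`, which gives
absolute continuity of the whole path. -/
theorem pathAction_le_of_lipschitzOnWith {X : Type*} [PseudoMetricSpace X] {ω : PathSpace T X}
    {K₁ K₂ : ℝ≥0} (h₁ : LipschitzOnWith K₁ (extendPath ω) (Icc 0 (T / 2)))
    (h₂ : LipschitzOnWith K₂ (extendPath ω) (Icc (T / 2) T)) :
    pathAction ω ≤ ENNReal.ofReal (T ^ 2 / 4) * (K₁ ^ 2 + K₂ ^ 2) := by
  have hT0 : 0 < T := hT.out
  set u := extendPath ω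
  have hlip : LipschitzOnWith (max K₁ K₂) u (uIcc 0 T) := by
    rw [uIcc_of_le hT0.le]
    refine LipschitzOnWith.of_dist_le_mul ?_
    have h₁' := h₁.weaken (le_max_left K₁ K₂)
    have h₂' := h₂.weaken (le_max_right K₁ K₂)
    have key : ∀ s ∈ Icc 0 T, ∀ t ∈ Icc 0 T, s ≤ t →
        dist (u s) (u t) ≤ (max K₁ K₂ : ℝ≥0) * dist s t := by
      intro s hs t ht hst
      rcases le_total t (T / 2) with h | h
      · exact h₁'.dist_le_mul _ ⟨hs.1, hst.trans h⟩ _ ⟨ht.1, h⟩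
      rcases le_total s (T / 2) with h' | h'
      · have e1 := h₁'.dist_le_mul s ⟨hs.1, h'⟩ (T / 2) ⟨by linarith, le_rfl⟩
        have e2 := h₂'.dist_le_mul (T / 2) ⟨le_rfl, by linarith⟩ t ⟨h, ht.2⟩
        have e3 : dist s t = dist s (T / 2) + dist (T / 2) t := by
          simp only [Real.dist_eq]
          rw [abs_of_nonpos (by linarith), abs_of_nonpos (by linarith),
            abs_of_nonpos (by linarith)]
          ring
        rw [e3, mul_add]
        exact (dist_triangle _ (u (T / 2)) _).trans (add_le_add e1 e2)
      · exact h₂'.dist_le_mul _ ⟨h', hs.2⟩ _ ⟨h, ht.2⟩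
    intro s hs t ht
    rcases le_total s t with h | h
    · exact key s hs t ht h
    · rw [dist_comm, dist_comm s]
      exact key t ht s hs h
  have hhalf : ∀ {a b : ℝ} {K : ℝ≥0}, LipschitzOnWith K u (Icc a b) → b - a = T / 2 →
      ∫⁻ t in Icc a b, speed u t ^ 2 / 2 ≤ K ^ 2 / 2 * ENNReal.ofReal (T / 2) := by
    intro a b K h hab
    rw [← restrict_Ioo_eq_restrict_Icc]
    calc _ ≤ ∫⁻ _ in Ioo a b, (K : ℝ≥0∞) ^ 2 / 2 :=
          setLIntegral_mono measurable_const fun t ht => ENNReal.div_le_div_right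
            (pow_le_pow_left' (speed_le_of_lipschitzOnWith h (Icc_mem_nhds ht.1 ht.2)) 2) _
      _ = _ := by rw [setLIntegral_const, Real.volume_Ioo, hab]
  rw [pathAction, if_pos hlip.absolutelyContinuousOnInterval,
    ← Icc_union_Icc_eq_Icc (show (0 : ℝ) ≤ T / 2 by linarith) (show T / 2 ≤ T by linarith)]
  calc _ ≤ ENNReal.ofReal T * (K₁ ^ 2 / 2 * ENNReal.ofReal (T / 2) +
        K₂ ^ 2 / 2 * ENNReal.ofReal (T / 2)) := by
        gcongr
        exact (lintegral_union_le _ _ _).trans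
          (add_le_add (hhalf h₁ (by ring)) (hhalf h₂ (by ring)))
    _ = ENNReal.ofReal T * ENNReal.ofReal (T / 2) * 2⁻¹ * (K₁ ^ 2 + K₂ ^ 2) := by
        simp only [div_eq_mul_inv]; ring
    _ = _ := by
        congr 1
        rw [← ENNReal.ofReal_ofNat, ← ENNReal.ofReal_inv_of_pos two_pos,
          ← ENNReal.ofReal_mul hT0.le, ← ENNReal.ofReal_mul (by positivity)]
        congr 1; ring

end PiecewiseLipschitz

/-! ### Projection, lift and Haar measure of the torus -/

section TorusMaps

variable {d : ℕ}

/-- The canonical projection `ℝᵈ → 𝕋ᵈ`. -/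
def torusProj (v : EuclideanSpace ℝ (Fin d)) : Torus d :=
  WithLp.toLp 2 fun i => (v i : UnitAddCircle)

/-- The measurable section of the projection with values in the cube `(-1/2, 1/2]ᵈ`. -/
def torusLift (z : Torus d) : EuclideanSpace ℝ (Fin d) :=
  WithLp.toLp 2 fun i => (AddCircle.measurableEquivIoc 1 (-1 / 2) (z i) : ℝ)

theorem torusProj_torusLift (z : Torus d) : torusProj (torusLift z) = z := by
  ext i
  exact AddCircle.coe_equivIoc (p := (1 : ℝ)) (a := -1 / 2)

theorem torusProj_zero : torusProj (0 : EuclideanSpace ℝ (Fin d)) = 0 := by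
  ext i
  simp [torusProj]

theorem _root_.UnitAddCircle.dist_coe_le (a b : ℝ) :
    dist (a : UnitAddCircle) (b : UnitAddCircle) ≤ dist a b := by
  rw [dist_eq_norm, ← AddCircle.coe_sub, UnitAddCircle.norm_eq, Real.dist_eq]
  simpa using round_le (a - b) 0

theorem lipschitzWith_torusProj : LipschitzWith 1 (torusProj (d := d)) := by
  refine LipschitzWith.of_dist_le_mul fun v w => ?_
  rw [NNReal.coe_one, one_mul, PiLp.dist_eq_of_L2, EuclideanSpace.dist_eq]
  refine Real.sqrt_le_sqrt (Finset.sum_le_sum fun i _ => ?_)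
  exact pow_le_pow_left₀ dist_nonneg (UnitAddCircle.dist_coe_le _ _) 2

theorem measurable_torusLift : Measurable (torusLift (d := d)) := by
  refine (MeasurableEquiv.toLp 2 (Fin d → ℝ)).measurable.comp (measurable_pi_lambda _ fun i => ?_)
  refine measurable_subtype_coe.comp ((AddCircle.measurableEquivIoc 1 (-1 / 2)).measurable.comp ?_)
  exact (measurable_pi_apply i).comp
    (MeasurableEquiv.toLp 2 (Fin d → UnitAddCircle)).symm.measurable

instance : IsProbabilityMeasure (volume : Measure UnitAddCircle) := ⟨UnitAddCircle.measure_univ⟩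

theorem measurePreserving_toLp_torusMeasure :
    MeasurePreserving (WithLp.toLp 2) (Measure.pi fun _ : Fin d => (volume : Measure UnitAddCircle))
      (torusMeasure d) :=
  ⟨(MeasurableEquiv.toLp 2 (Fin d → UnitAddCircle)).measurable, rfl⟩

instance : IsProbabilityMeasure (torusMeasure d) :=
  Measure.isProbabilityMeasure_map
    (MeasurableEquiv.toLp 2 (Fin d → UnitAddCircle)).measurable.aemeasurable

theorem map_add_right_torusMeasure (w : Torus d) :
    (torusMeasure d).map (fun z => z + w) = torusMeasure d := by
  have hm : Measurable (WithLp.toLp 2 : (Fin d → UnitAddCircle) → Torus d) :=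
    (MeasurableEquiv.toLp 2 (Fin d → UnitAddCircle)).measurable
  rw [torusMeasure, Measure.map_map (measurable_add_const w) hm]
  conv_rhs => rw [← map_add_right_eq_self
    (Measure.pi fun _ : Fin d => (volume : Measure UnitAddCircle)) w.ofLp,
    Measure.map_map hm (measurable_add_const _)]
  rfl

/-- The variance of the uniform law on `(-1/2, 1/2]`. -/
theorem lintegral_sq_equivIoc :
    ∫⁻ z : UnitAddCircle, ENNReal.ofReal
      ((AddCircle.measurableEquivIoc 1 (-1 / 2) z : ℝ) ^ 2) = ENNReal.ofReal (1 / 12) := by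
  rw [← UnitAddCircle.lintegral_preimage (-1 / 2)]
  rw [setLIntegral_congr_fun (g := fun x => ENNReal.ofReal (x ^ 2)) measurableSet_Ioc
    fun x hx => ?_]
  · have hle : (-1 / 2 : ℝ) ≤ -1 / 2 + 1 := by norm_num
    rw [← ofReal_integral_eq_lintegral_ofReal, ← intervalIntegral.integral_of_le hle, integral_pow]
    · norm_num
    · exact (intervalIntegrable_iff_integrableOn_Ioc_of_le hle).1
        ((continuous_pow 2).intervalIntegrable _ _)
    · exact Eventually.of_forall fun x => sq_nonneg x
  · have : (AddCircle.measurableEquivIoc 1 (-1 / 2) (x : UnitAddCircle) : ℝ) = x :=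
      congrArg Subtype.val (AddCircle.equivIoc_coe_eq hx)
    rw [this]

theorem lintegral_sq_norm_torusLift :
    ∫⁻ z, ‖torusLift z‖ₑ ^ 2 ∂torusMeasure d = ENNReal.ofReal (d / 12) := by
  rw [← measurePreserving_toLp_torusMeasure.lintegral_comp
    (measurable_torusLift.enorm.pow_const 2)]
  have h : ∀ z : Fin d → UnitAddCircle, ‖torusLift (WithLp.toLp 2 z : Torus d)‖ₑ ^ 2 =
      ∑ i, ENNReal.ofReal ((AddCircle.measurableEquivIoc 1 (-1 / 2) (z i) : ℝ) ^ 2) := by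
    intro z
    rw [← ENNReal.ofReal_sum_of_nonneg fun _ _ => sq_nonneg _, ← ofReal_norm,
      ← ENNReal.ofReal_pow (norm_nonneg _), EuclideanSpace.norm_sq_eq]
    simp only [Real.norm_eq_abs, sq_abs]
    rfl
  have hm : Measurable fun z : UnitAddCircle => ENNReal.ofReal
      ((AddCircle.measurableEquivIoc 1 (-1 / 2) z : ℝ) ^ 2) :=
    ((measurable_subtype_coe.comp
      (AddCircle.measurableEquivIoc 1 (-1 / 2)).measurable).pow_const 2).ennreal_ofReal
  simp only [h]
  rw [lintegral_finsetSum _ fun i _ => by exact hm.comp (measurable_pi_apply i)]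
  have h2 : ∀ i : Fin d, ∫⁻ z : Fin d → UnitAddCircle, ENNReal.ofReal
      ((AddCircle.measurableEquivIoc 1 (-1 / 2) (z i) : ℝ) ^ 2)
        ∂(Measure.pi fun _ => volume) = ENNReal.ofReal (1 / 12) := fun i => by
    rw [← lintegral_sq_equivIoc]
    exact (measurePreserving_eval
      (fun _ : Fin d => (volume : Measure UnitAddCircle)) i).lintegral_comp hm
  simp only [h2, Finset.sum_const, Finset.card_univ, Fintype.card_fin, nsmul_eq_mul]
  rw [← ENNReal.ofReal_natCast, ← ENNReal.ofReal_mul (by positivity)]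
  congr 1; ring

end TorusMaps

/-! ### The two-step flow through a uniform random point -/

section TorusFlow

variable {d : ℕ}

/-- For `x` and `z` independent and uniform, `x` and `z - x` are again independent and uniform;
conditionally on `z - x`, the position is a fixed translate of `x`. This is the source of
incompressibility. -/
theorem map_add_comp_torusMeasure {k : Torus d → Torus d} (hk : Measurable k) :
    ((torusMeasure d).prod (torusMeasure d)).map (fun p => p.1 + k (p.2 - p.1)) =
      torusMeasure d := by
  have hmp : MeasurePreserving (fun p : Torus d × Torus d => p.1 + k p.2)
      ((torusMeasure d).prod (torusMeasure d)) (torusMeasure d) := by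
    refine ⟨by fun_prop, ?_⟩
    ext s hs
    rw [Measure.map_apply (by fun_prop) hs, Measure.prod_apply_symm ((by fun_prop :
      Measurable fun p : Torus d × Torus d => p.1 + k p.2) hs)]
    have : ∀ w : Torus d, torusMeasure d ((fun x => (x, w)) ⁻¹'
        ((fun p : Torus d × Torus d => p.1 + k p.2) ⁻¹' s)) = torusMeasure d s := by
      intro w
      conv_rhs => rw [← map_add_right_torusMeasure (k w), Measure.map_apply (by fun_prop) hs]
      rfl
    simp [this]
  have : (torusMeasure d).IsAddRightInvariant := ⟨map_add_right_torusMeasure⟩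
  exact (hmp.comp (measurePreserving_prod_sub (torusMeasure d) (torusMeasure d))).map_eq

/-- The ramp equal to `0` before time `0`, to `1` after time `T/2`, and affine in between. -/
def ramp (T t : ℝ) : ℝ := min (max (2 * t / T) 0) 1

theorem continuous_ramp (T : ℝ) : Continuous (ramp T) := by
  unfold ramp; fun_prop

theorem ramp_of_nonpos {T t : ℝ} (hT : 0 < T) (ht : t ≤ 0) : ramp T t = 0 := by
  have : 2 * t / T ≤ 0 := div_nonpos_of_nonpos_of_nonneg (by linarith) hT.le
  simp [ramp, max_eq_right this]

theorem ramp_of_half_le {T t : ℝ} (hT : 0 < T) (ht : T / 2 ≤ t) : ramp T t = 1 := by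
  have : 1 ≤ 2 * t / T := by rw [le_div_iff₀ hT]; linarith
  exact min_eq_right (this.trans (le_max_left _ _))

theorem abs_ramp_sub_le {T : ℝ} (hT : 0 < T) (s t : ℝ) :
    |ramp T s - ramp T t| ≤ 2 / T * |s - t| := by
  have h1 : |ramp T s - ramp T t| ≤ |2 * s / T - 2 * t / T| := by
    refine (abs_min_sub_min_le_max _ _ _ _).trans (max_le ?_ (by simp))
    exact (abs_max_sub_max_le_max _ _ _ _).trans (max_le le_rfl (by simp))
  refine h1.trans_eq ?_
  rw [show 2 * s / T - 2 * t / T = 2 / T * (s - t) by ring, abs_mul, abs_of_pos (by positivity)]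

/-- The curve starting at `x`, moving by `y` during the first half of the time interval and by
`-y'` during the second half. -/
def torusCurve (T : ℝ) (p : Torus d × EuclideanSpace ℝ (Fin d) × EuclideanSpace ℝ (Fin d))
    (t : ℝ) : Torus d :=
  p.1 + torusProj (ramp T t • p.2.1) - torusProj (ramp T (t - T / 2) • p.2.2)

/-- The curves `torusCurve` as a continuous family of elements of the path space. -/
def torusPath (d : ℕ) (T : ℝ) :
    C(Torus d × EuclideanSpace ℝ (Fin d) × EuclideanSpace ℝ (Fin d), PathSpace T (Torus d)) :=
  ContinuousMap.curry
    { toFun := fun q => torusCurve T q.1 q.2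
      continuous_toFun := by
        have h := (lipschitzWith_torusProj (d := d)).continuous
        have h' := continuous_ramp T
        unfold torusCurve
        fun_prop }

theorem pathAction_torusPath_le {T : ℝ} [hT : Fact (0 < T)]
    (p : Torus d × EuclideanSpace ℝ (Fin d) × EuclideanSpace ℝ (Fin d)) :
    pathAction (torusPath d T p) ≤ ‖p.2.1‖ₑ ^ 2 + ‖p.2.2‖ₑ ^ 2 := by
  have hT0 : 0 < T := hT.out
  -- The slope of the ramp: `T²/4 · (2/T)² = 1` removes `T` from the bound.
  let c : ℝ≥0 := ⟨2 / T, by positivity⟩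
  have hext : ∀ t ∈ Icc 0 T, extendPath (torusPath d T p) t = torusCurve T p t := fun t ht =>
    IccExtend_of_mem _ _ ht
  have hmove : ∀ (v : EuclideanSpace ℝ (Fin d)) (a b r : ℝ), |a - b| ≤ 2 / T * r →
      dist (torusProj (a • v)) (torusProj (b • v)) ≤ (c * ‖v‖₊ : ℝ≥0) * r := by
    intro v a b r h
    refine (lipschitzWith_torusProj.dist_le_mul _ _).trans ?_
    rw [NNReal.coe_one, one_mul, dist_eq_norm, ← sub_smul, norm_smul, Real.norm_eq_abs]
    refine (mul_le_mul_of_nonneg_right h (norm_nonneg v)).trans_eq ?_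
    rw [NNReal.coe_mul, coe_nnnorm]
    change 2 / T * r * ‖v‖ = 2 / T * ‖v‖ * r
    ring
  have h₁ : LipschitzOnWith (c * ‖p.2.1‖₊) (extendPath (torusPath d T p)) (Icc 0 (T / 2)) := by
    refine LipschitzOnWith.of_dist_le_mul fun s hs t ht => ?_
    rw [hext s ⟨hs.1, by linarith [hs.2]⟩, hext t ⟨ht.1, by linarith [ht.2]⟩, torusCurve,
      torusCurve, ramp_of_nonpos hT0 (sub_nonpos.2 hs.2), ramp_of_nonpos hT0 (sub_nonpos.2 ht.2),
      dist_sub_right, dist_add_left]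
    exact hmove _ _ _ _ (abs_ramp_sub_le hT0 s t)
  have h₂ : LipschitzOnWith (c * ‖p.2.2‖₊) (extendPath (torusPath d T p)) (Icc (T / 2) T) := by
    refine LipschitzOnWith.of_dist_le_mul fun s hs t ht => ?_
    rw [hext s ⟨by linarith [hs.1], hs.2⟩, hext t ⟨by linarith [ht.1], ht.2⟩, torusCurve,
      torusCurve, ramp_of_half_le hT0 hs.1, ramp_of_half_le hT0 ht.1, dist_sub_left]
    refine hmove _ _ _ _ ((abs_ramp_sub_le hT0 _ _).trans_eq ?_)
    rw [sub_sub_sub_cancel_right, Real.dist_eq]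
  refine (pathAction_le_of_lipschitzOnWith h₁ h₂).trans_eq ?_
  have hc : ENNReal.ofReal (T ^ 2 / 4) * (c : ℝ≥0∞) ^ 2 = 1 := by
    rw [← ENNReal.ofReal_coe_nnreal, ← ENNReal.ofReal_pow c.coe_nonneg,
      ← ENNReal.ofReal_mul (by positivity), ← ENNReal.ofReal_one]
    congr 1
    change T ^ 2 / 4 * (2 / T) ^ 2 = 1
    field_simp
    norm_num
  rw [ENNReal.coe_mul, ENNReal.coe_mul, mul_pow, mul_pow, ← mul_add, ← mul_assoc, hc, one_mul]
  rfl

theorem relaxedDistSq_torus_le {T : ℝ} [hT : Fact (0 < T)]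
    {η γ : ProbabilityMeasure (Torus d × Torus d)} (hη : η ∈ plans (torusMeasure d))
    (hγ : γ ∈ plans (torusMeasure d)) :
    relaxedDistSq T (torusMeasure d) η γ ≤ ENNReal.ofReal (d / 6) := by
  have hT0 : 0 < T := hT.out
  set μ := torusMeasure d with hμ
  -- Under `π`, `((a, x), b)` has `(a, x)` of law `η` and `(a, b)` of law `γ`.
  obtain ⟨π, _, hπ1, hπ2⟩ := exists_gluing (η : Measure (Torus d × Torus d)) measurable_fst
    (γ : Measure (Torus d × Torus d)) (hη.1.trans hγ.1.symm)
  let P : Measure (((Torus d × Torus d) × Torus d) × Torus d) := π.prod μ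
  let a : ((Torus d × Torus d) × Torus d) × Torus d → Torus d := fun w => w.1.1.1
  let x : ((Torus d × Torus d) × Torus d) × Torus d → Torus d := fun w => w.1.1.2
  let b : ((Torus d × Torus d) × Torus d) × Torus d → Torus d := fun w => w.1.2
  let z : ((Torus d × Torus d) × Torus d) × Torus d → Torus d := fun w => w.2
  have ha : Measurable a := by fun_prop
  have hx : Measurable x := by fun_prop
  have hb : Measurable b := by fun_prop
  have hz : Measurable z := by fun_prop
  have hfst : P.map Prod.fst = π := by
    rw [Measure.map_fst_prod, measure_univ, one_smul]
  have hax : P.map (fun w => (a w, x w)) = η := by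
    rw [← hπ1, ← hfst, Measure.map_map measurable_fst measurable_fst]; rfl
  have hab : P.map (fun w => (a w, b w)) = γ := by
    rw [← hπ2, ← hfst, Measure.map_map (by fun_prop) measurable_fst]; rfl
  have hindep : ∀ {k : (Torus d × Torus d) × Torus d → Torus d}, Measurable k → π.map k = μ →
      P.map (fun w => (k w.1, w.2)) = μ.prod μ := by
    intro k hk hkμ
    have := Measure.map_prod_map π μ hk measurable_id
    rw [hkμ, Measure.map_id] at this
    exact this.symm
  have hxz : P.map (fun w => (x w, z w)) = μ.prod μ := by
    refine hindep (k := fun w => w.1.2) (by fun_prop) ?_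
    rw [← hη.2, ← hπ1, Measure.map_map measurable_snd measurable_fst]; rfl
  have hbz : P.map (fun w => (b w, z w)) = μ.prod μ := by
    refine hindep (k := fun w => w.2) (by fun_prop) ?_
    rw [← hγ.2, ← hπ2, Measure.map_map measurable_snd (by fun_prop)]; rfl
  let q : ((Torus d × Torus d) × Torus d) × Torus d →
      Torus d × EuclideanSpace ℝ (Fin d) × EuclideanSpace ℝ (Fin d) := fun w =>
    (x w, torusLift (z w - x w), torusLift (z w - b w))
  have hq : Measurable q := hx.prodMk ((measurable_torusLift.comp (hz.sub hx)).prodMk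
    (measurable_torusLift.comp (hz.sub hb)))
  let Ψ : ((Torus d × Torus d) × Torus d) × Torus d → PathSpace T (Torus d) × Torus d :=
    fun w => (torusPath d T (q w), a w)
  have hΨ : Measurable Ψ := ((torusPath d T).continuous.measurable.comp hq).prodMk ha
  let ν : ProbabilityMeasure (PathSpace T (Torus d) × Torus d) :=
    ⟨P.map Ψ, Measure.isProbabilityMeasure_map hΨ.aemeasurable⟩
  have hν : (ν : Measure (PathSpace T (Torus d) × Torus d)) = P.map Ψ := rfl
  have hflow : IsGenFlow T μ η γ ν := by
    refine ⟨?_, fun t => ?_, ?_, ?_⟩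
    · rw [hν, Measure.map_map measurable_snd hΨ, ← hη.1, ← hax,
        Measure.map_map measurable_fst (ha.prodMk hx)]
      rfl
    · rw [hν, Measure.map_map (measurable_position t) hΨ]
      have hproj := (lipschitzWith_torusProj (d := d)).continuous.measurable
      rcases le_total (t : ℝ) (T / 2) with h | h
      · have hk : Measurable fun w : Torus d => torusProj (ramp T t • torusLift w) :=
          hproj.comp ((measurable_const_smul _).comp measurable_torusLift)
        rw [hμ, ← map_add_comp_torusMeasure hk, ← hμ, ← hxz,
          Measure.map_map
            (by exact measurable_fst.add (hk.comp (measurable_snd.sub measurable_fst)))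
            (hx.prodMk hz)]
        congr 1
        ext1 w
        change torusCurve T (q w) t = _
        rw [torusCurve, ramp_of_nonpos hT0 (sub_nonpos.2 h), zero_smul, torusProj_zero, sub_zero]
        rfl
      -- In the second half the position is read from the endpoint `b`: `z` minus a part of the lift
      -- of `z - b` is `b` plus a function of `z - b`.
      · have hk : Measurable fun w : Torus d =>
            w - torusProj (ramp T (t - T / 2) • torusLift w) :=
          measurable_id.sub (hproj.comp ((measurable_const_smul _).comp measurable_torusLift))
        rw [hμ, ← map_add_comp_torusMeasure hk, ← hμ, ← hbz,
          Measure.map_map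
            (by exact measurable_fst.add (hk.comp (measurable_snd.sub measurable_fst)))
            (hb.prodMk hz)]
        congr 1
        ext1 w
        change torusCurve T (q w) t = b w + (z w - b w - torusProj (_ • torusLift (z w - b w)))
        rw [torusCurve, ramp_of_half_le hT0 h, one_smul, torusProj_torusLift]
        change x w + (z w - x w) - _ = _
        rw [add_sub_cancel, ← add_sub_assoc, add_sub_cancel]
    · rw [hν, Measure.map_map (measurable_label_position _) hΨ, ← hax]
      congr 1
      ext1 w
      change (a w, torusCurve T (q w) 0) = _
      rw [torusCurve, ramp_of_nonpos hT0 le_rfl, ramp_of_nonpos hT0 (by linarith), zero_smul,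
        zero_smul, torusProj_zero, add_zero, sub_zero]
    · rw [hν, Measure.map_map (measurable_label_position _) hΨ, ← hab]
      congr 1
      ext1 w
      change (a w, torusCurve T (q w) T) = _
      rw [torusCurve, ramp_of_half_le hT0 (by linarith), ramp_of_half_le hT0 (by linarith),
        one_smul, one_smul, torusProj_torusLift, torusProj_torusLift]
      change (a w, x w + (z w - x w) - (z w - b w)) = _
      rw [add_sub_cancel, sub_sub_cancel]
  have hcost : ∀ {k : ((Torus d × Torus d) × Torus d) × Torus d → Torus d}, Measurable k →
      P.map (fun w => (k w, z w)) = μ.prod μ →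
      ∫⁻ w, ‖torusLift (z w - k w)‖ₑ ^ 2 ∂P = ENNReal.ofReal (d / 12) := by
    intro k hk hkz
    have hm : Measurable fun v : Torus d => ‖torusLift v‖ₑ ^ 2 :=
      measurable_torusLift.enorm.pow_const 2
    have : μ.IsAddRightInvariant := ⟨map_add_right_torusMeasure⟩
    have hsnd : MeasurePreserving (fun p : Torus d × Torus d => p.2 - p.1) (μ.prod μ) μ :=
      measurePreserving_snd.comp (measurePreserving_prod_sub μ μ)
    rw [← lintegral_sq_norm_torusLift, ← hμ, ← hsnd.lintegral_comp hm, ← hkz,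
      lintegral_map (by exact hm.comp (measurable_snd.sub measurable_fst)) (hk.prodMk hz)]
  calc relaxedDistSq T μ η γ ≤ flowAction ν := iInf₂_le ν hflow
    _ = ∫⁻ p, pathAction p.1 ∂P.map Ψ := rfl
    _ ≤ ∫⁻ w, pathAction (torusPath d T (q w)) ∂P :=
        lintegral_map_le (fun p : PathSpace T (Torus d) × Torus d => pathAction p.1) Ψ
    _ ≤ ∫⁻ w, ‖torusLift (z w - x w)‖ₑ ^ 2 + ‖torusLift (z w - b w)‖ₑ ^ 2 ∂P :=
        lintegral_mono fun w => pathAction_torusPath_le (q w)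
    _ = ENNReal.ofReal (d / 12) + ENNReal.ofReal (d / 12) := by
        rw [lintegral_add_left, hcost hx hxz, hcost hb hbz]
        exact (measurable_torusLift.comp (hz.sub hx)).enorm.pow_const 2
    _ = ENNReal.ofReal (d / 6) := by
        rw [← ENNReal.ofReal_add (by positivity) (by positivity)]
        congr 1; ring

theorem relaxedDist_torus_le {T : ℝ} [hT : Fact (0 < T)]
    {η γ : ProbabilityMeasure (Torus d × Torus d)} (hη : η ∈ plans (torusMeasure d))
    (hγ : γ ∈ plans (torusMeasure d)) :
    relaxedDist T (torusMeasure d) η γ ≤ ENNReal.ofReal √(d / 6) := by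
  refine (ENNReal.rpow_le_rpow (relaxedDistSq_torus_le hη hγ) (by norm_num)).trans_eq ?_
  rw [ENNReal.ofReal_rpow_of_nonneg (by positivity) (by norm_num), Real.sqrt_eq_rpow]

end TorusFlow

/-! ### The cube as a folded torus -/

section Cube

variable {d : ℕ}

/-- The folding map `𝕋ᵈ → [0,1]ᵈ`, equal in each coordinate to twice the distance to `0`. -/
def foldTorus (z : Torus d) : cube d :=
  ⟨WithLp.toLp 2 fun i => 2 * ‖z i‖, fun i => by
    have h := AddCircle.norm_le_half_period (1 : ℝ) (x := z i) one_ne_zero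
    rw [abs_one] at h
    exact ⟨by positivity, by change 2 * ‖z i‖ ≤ 1; linarith⟩⟩

theorem lipschitzWith_foldTorus : LipschitzWith 2 (foldTorus (d := d)) := by
  refine LipschitzWith.of_dist_le_mul fun v w => ?_
  rw [Subtype.dist_eq, EuclideanSpace.dist_eq, PiLp.dist_eq_of_L2]
  rw [show ((2 : ℝ≥0) : ℝ) = √(2 ^ 2) by rw [Real.sqrt_sq zero_le_two]; rfl,
    ← Real.sqrt_mul (by positivity), Finset.mul_sum]
  refine Real.sqrt_le_sqrt (Finset.sum_le_sum fun i _ => ?_)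
  rw [← mul_pow]
  refine pow_le_pow_left₀ dist_nonneg ?_ 2
  change |2 * ‖v i‖ - 2 * ‖w i‖| ≤ _
  rw [← mul_sub, abs_mul, abs_two, dist_eq_norm]
  gcongr
  exact abs_norm_sub_norm_le _ _

theorem map_two_mul_norm_unitAddCircle :
    (volume : Measure UnitAddCircle).map (fun z => 2 * ‖z‖) = volume.restrict (Icc (0 : ℝ) 1) := by
  have hm : Measurable fun z : UnitAddCircle => 2 * ‖z‖ := by fun_prop
  have := Measure.isFiniteMeasure_map (volume : Measure UnitAddCircle) fun z => 2 * ‖z‖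
  refine Measure.ext_of_Iic _ _ fun a => ?_
  rw [Measure.map_apply hm measurableSet_Iic, Measure.restrict_apply measurableSet_Iic]
  -- Half-lines pull back to closed balls about `0`, whose volume is explicit, so the distribution
  -- functions can be compared.
  have h1 : (fun z : UnitAddCircle => 2 * ‖z‖) ⁻¹' Iic a = Metric.closedBall 0 (a / 2) := by
    ext z
    simp only [mem_preimage, mem_Iic, mem_closedBall_zero_iff]
    rw [le_div_iff₀ two_pos, mul_comm]
  have h2 : Iic a ∩ Icc 0 1 = Icc 0 (min 1 a) := by
    ext t; simp only [mem_inter_iff, mem_Iic, mem_Icc, le_min_iff]; tauto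
  rw [h1, AddCircle.volume_closedBall, h2, Real.volume_Icc, sub_zero, mul_div_cancel₀ _ two_ne_zero]

theorem measurableSet_cube : MeasurableSet (cube d) := by
  have : IsClosed (cube d) := by
    simp only [cube, ofPred_forall]
    exact isClosed_iInter fun i => isClosed_Icc.preimage (by fun_prop)
  exact this.measurableSet

/-- Folding acts on each coordinate, so this is `map_two_mul_norm_unitAddCircle` for product
measures; the comparison is made in `ℝᵈ` and pulled back along the inclusion of the cube. -/
theorem map_foldTorus : (torusMeasure d).map foldTorus = cubeMeasure d := by
  have hf : Measurable (foldTorus (d := d)) := lipschitzWith_foldTorus.continuous.measurable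
  have hval : MeasurableEmbedding (Subtype.val : cube d → EuclideanSpace ℝ (Fin d)) :=
    MeasurableEmbedding.subtype_coe measurableSet_cube
  have hT : Measurable (WithLp.toLp 2 : (Fin d → UnitAddCircle) → Torus d) :=
    (MeasurableEquiv.toLp 2 (Fin d → UnitAddCircle)).measurable
  have hE : Measurable (WithLp.toLp 2 : (Fin d → ℝ) → EuclideanSpace ℝ (Fin d)) :=
    (MeasurableEquiv.toLp 2 (Fin d → ℝ)).measurable
  have hm : Measurable fun z : UnitAddCircle => 2 * ‖z‖ := by fun_prop
  have key : ((torusMeasure d).map foldTorus).map Subtype.val =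
      (cubeMeasure d).map (Subtype.val : cube d → EuclideanSpace ℝ (Fin d)) := by
    rw [cubeMeasure, hval.map_comap, Subtype.range_coe, torusMeasure,
      Measure.map_map hval.measurable hf, Measure.map_map (hval.measurable.comp hf) hT]
    have h1 : ((Subtype.val ∘ foldTorus) ∘ WithLp.toLp 2 :
        (Fin d → UnitAddCircle) → EuclideanSpace ℝ (Fin d)) =
        WithLp.toLp 2 ∘ fun z i => 2 * ‖z i‖ := rfl
    rw [h1, ← Measure.map_map hE (by fun_prop)]
    have : ∀ _i : Fin d, SigmaFinite ((volume : Measure UnitAddCircle).map fun z => 2 * ‖z‖) :=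
      fun _ => by rw [map_two_mul_norm_unitAddCircle]; infer_instance
    rw [Measure.pi_map_pi (f := fun (_ : Fin d) (z : UnitAddCircle) => 2 * ‖z‖)
      (fun _ => hm.aemeasurable), map_two_mul_norm_unitAddCircle, ← Measure.restrict_pi_pi,
      ← (PiLp.volume_preserving_toLp (Fin d)).map_eq, Measure.restrict_map hE measurableSet_cube]
    congr 2
    ext v
    simp only [mem_univ_pi]
    rfl
  rw [← hval.comap_map ((torusMeasure d).map foldTorus), key, hval.comap_map]

theorem relaxedDist_cube_le {T : ℝ} [hT : Fact (0 < T)]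
    {η γ : ProbabilityMeasure (cube d × cube d)} (hη : η ∈ plans (cubeMeasure d))
    (hγ : γ ∈ plans (cubeMeasure d)) :
    relaxedDist T (cubeMeasure d) η γ ≤ ENNReal.ofReal √d := by
  have hf : Measurable (foldTorus (d := d)) := lipschitzWith_foldTorus.continuous.measurable
  obtain ⟨η', hη', hη2⟩ := exists_plan_map_eq hf map_foldTorus hη
  obtain ⟨γ', hγ', hγ2⟩ := exists_plan_map_eq hf map_foldTorus hγ
  rw [← hη2, ← hγ2]
  calc _ ≤ ((2 : ℝ≥0) : ℝ≥0∞) * relaxedDist T (torusMeasure d) η' γ' :=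
        relaxedDist_map_le two_ne_zero lipschitzWith_foldTorus map_foldTorus _ _
    _ ≤ ((2 : ℝ≥0) : ℝ≥0∞) * ENNReal.ofReal √(d / 6) := by
        gcongr; exact relaxedDist_torus_le hη' hγ'
    _ ≤ ENNReal.ofReal √d := by
        rw [← ENNReal.ofReal_coe_nnreal, ← ENNReal.ofReal_mul (by positivity)]
        -- The square of `2 √(d/6)` is `2d/3`, which leaves room below `d`.
        refine ENNReal.ofReal_le_ofReal (Real.le_sqrt_of_sq_le ?_)
        rw [mul_pow, Real.sq_sqrt (by positivity)]
        have : (0 : ℝ) ≤ d := by positivity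
        norm_num
        linarith

end Cube

end GenFlow

end

/-! ### The theorem -/

open GenFlow in
theorem theorem3p2 (T : ℝ) [Fact (0 < T)] :
    -- compact subsets `D` of `ℝᵈ` with a reference probability measure `μ`
    (∀ (d : ℕ) (D : Set (EuclideanSpace ℝ (Fin d))), IsCompact D →
      ∀ (μ : Measure D) [IsProbabilityMeasure μ],
        -- the infimum is attained as soon as there is a competitor
        (∀ η ∈ plans μ, ∀ γ ∈ plans μ,
          (∃ ν : ProbabilityMeasure (PathSpace T D × D), IsGenFlow T μ η γ ν) →
          ∃ ν : ProbabilityMeasure (PathSpace T D × D),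
            IsGenFlow T μ η γ ν ∧ flowAction ν = relaxedDistSq T μ η γ) ∧
        -- narrow lower semicontinuity
        LowerSemicontinuous (fun p : plans μ × plans μ =>
          relaxedDist T μ (p.1 : ProbabilityMeasure (D × D)) (p.2 : ProbabilityMeasure (D × D))) ∧
        -- comparison with the Arnold distance
        (∀ h ∈ SDiff μ, relaxedDist T μ (planOfMap μ id) (planOfMap μ h) ≤
          arnoldDist T μ (Homeomorph.refl D) h)) ∧
    -- diameter bound for the cube
    (∀ d : ℕ, (⨆ η ∈ plans (cubeMeasure d), ⨆ γ ∈ plans (cubeMeasure d),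
      relaxedDist T (cubeMeasure d) η γ) ≤ ENNReal.ofReal (√d)) ∧
    -- diameter bound for the flat torus
    (∀ d : ℕ, (⨆ η ∈ plans (torusMeasure d), ⨆ γ ∈ plans (torusMeasure d),
      relaxedDist T (torusMeasure d) η γ) ≤ ENNReal.ofReal (√d)) ∧
    -- transfer along a Lipschitz measure-preserving map `f : D' → D`
    (∀ (X X' : Type*) [MetricSpace X] [CompactSpace X] [MeasurableSpace X] [BorelSpace X]
      [MetricSpace X'] [CompactSpace X'] [MeasurableSpace X'] [BorelSpace X']
      (μ : Measure X) [IsProbabilityMeasure μ] (μ' : Measure X') [IsProbabilityMeasure μ']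
      (f : X' → X) (K : ℝ≥0), LipschitzWith K f → μ'.map f = μ →
      (⨆ γ ∈ plans μ, relaxedDist T μ (planOfMap μ id) γ) ≤
        K * (⨆ γ' ∈ plans μ', relaxedDist T μ' (planOfMap μ' id) γ')) := by
  refine ⟨fun d D hD μ _ => ?_, fun d => ?_, fun d => ?_, ?_⟩
  · have := isCompact_iff_compactSpace.1 hD
    have hlsc := lowerSemicontinuous_pathAction (T := T) (D := D)
    have hcpt : ∀ C ≠ ∞, IsCompact {ω : PathSpace T D | pathAction ω ≤ C} :=
      fun C hC => isCompact_pathAction_le hD hC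
    refine ⟨fun η _ γ _ hex => exists_isGenFlow_flowAction_eq μ hlsc hcpt η γ hex,
      lowerSemicontinuous_relaxedDist_plans μ hlsc hcpt,
      fun h _ => relaxedDist_le_arnoldDist hD μ h⟩
  · exact iSup₂_le fun η hη => iSup₂_le fun γ hγ => relaxedDist_cube_le hη hγ
  · refine iSup₂_le fun η hη => iSup₂_le fun γ hγ => (relaxedDist_torus_le hη hγ).trans ?_
    have : (0 : ℝ) ≤ d := by positivity
    exact ENNReal.ofReal_le_ofReal (Real.sqrt_le_sqrt (by linarith))
  · intro X X' _ _ _ _ _ _ _ _ μ _ μ' _ f K hf hμ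
    exact iSup_relaxedDist_le_mul hf hμ
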